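/- All graphs are finite, simple and undirected. A graph $G$ is \emph{2-degenerate} if every non-empty subgraph of $G$ has a vertex whose degree in that subgraph is at most $2$. Let $G$ be a 2-degenerate graph on $n$ vertices, not necessarily connected, such that no connected component of $G$ is a triangle. Then the edges of $G$ can be decomposed into at most $\lfloor n/2 \rfloor$ paths; that is, the edge set of $G$ can be partitioned into at most $\lfloor n/2 \rfloor$ sets, each of which is the edge set of a path in $G$ (a walk in which all vertices and edges are distinct). -/

import Mathlib

namespace SimpleGraph

/-- A graph is `k`-degenerate if every subgraph (with at least one vertex) has a vertex whose
degree in that subgraph is at most `k`. -/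
def IsDegenerate {V : Type*} (G : SimpleGraph V) (k : ℕ) : Prop :=
  ∀ H : G.Subgraph, H.verts.Nonempty → ∃ v ∈ H.verts, (H.neighborSet v).encard ≤ k

/-- `P` is a path decomposition of `G`: `P` is a partition of the edge set of `G`, each part of
which is the edge set of a path in `G`. (The parts of a `Finpartition` are nonempty, pairwise
disjoint, and have union `G.edgeFinset`.) -/
def IsPathDecomposition {V : Type*} [Fintype V] [DecidableEq V] (G : SimpleGraph V)
    [DecidableRel G.Adj] (P : Finpartition G.edgeFinset) : Prop :=
  ∀ s ∈ P.parts, ∃ (u v : V) (p : G.Walk u v), p.IsPath ∧ p.edges.toFinset = s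

end SimpleGraph

/-! The proof is by induction on the number n of vertices: delete a small set C of vertices and a
set X of edges containing all edges at C, decompose the rest, and restore X with few new paths.
Deleting one vertex pays for a path when n is even; deleting two always does. A triangle needs two
paths but its three vertices pay for only one, and deletion may create triangle components.
`HoldsBelow.of_delete` treats these uniformly. Such a triangle meets X, since it was not a component
before. If it also has a vertex off X, then a path through a vertex shared with X can be rerouted so
that path and triangle become two paths (`Decomposes.absorb_cycle`).

For even n a vertex of degree at most two is deleted. For odd n, if two vertices of degree at most
two have a common neighbour, both are deleted (`HoldsBelow.of_two_low_neighbors`). Otherwise either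
every degree is at most one, or degeneracy applied to the vertices of degree at least three yields a
vertex u of degree three with exactly one neighbour s of degree at most two (`exists_pivot`).

In this last case s and u are deleted. Their edges never form a single path, so they are split into
a new path and a tail; the tail is attached for free to a path ending at a vertex v of odd degree in
the rest (`Decomposes.extend`). If the parity at v is wrong, the new path is enlarged by a shortest
path with end v that avoids s and u. Such a path is chordless, so a triangle left in the rest cannot
have two vertices on it. If no shortest path exists, there is a bridge, one side of which has even
order (`HoldsBelow.of_bridge`). -/

namespace PathDecomposition

/-! ### Paths as vertex lists, and sums of their edge multisets -/

variable {V : Type*}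

/-- The multiset of edges joining consecutive vertices of a list. -/
def pathEdges : List V → Multiset (Sym2 V)
  | [] => 0
  | [_] => 0
  | a :: b :: l => s(a, b) ::ₘ pathEdges (b :: l)

@[simp] lemma pathEdges_nil : pathEdges ([] : List V) = 0 := rfl

@[simp] lemma pathEdges_singleton (a : V) : pathEdges [a] = 0 := rfl

@[simp] lemma pathEdges_cons_cons (a b : V) (l : List V) :
    pathEdges (a :: b :: l) = s(a, b) ::ₘ pathEdges (b :: l) := rfl

lemma pathEdges_append_cons (l₁ : List V) (a : V) (l₂ : List V) :
    pathEdges (l₁ ++ a :: l₂) = pathEdges (l₁ ++ [a]) + pathEdges (a :: l₂) := by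
  induction l₁ with
  | nil => simp
  | cons b l₁ ih =>
    cases l₁ with
    | nil => simp
    | cons c l₁ => simpa using ih

lemma pathEdges_concat (l : List V) (a b : V) :
    pathEdges (l ++ [a, b]) = s(a, b) ::ₘ pathEdges (l ++ [a]) := by
  rw [pathEdges_append_cons, pathEdges_cons_cons, pathEdges_singleton, Multiset.cons_zero,
    add_comm, Multiset.singleton_add]

lemma pathEdges_reverse (l : List V) : pathEdges l.reverse = pathEdges l := by
  induction l with
  | nil => rfl
  | cons a l ih =>
    cases l with
    | nil => rfl
    | cons b l =>
      rw [List.reverse_cons, List.reverse_cons, List.append_assoc]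
      simp only [List.cons_append, List.nil_append, pathEdges_cons_cons]
      rw [pathEdges_concat, ← List.reverse_cons, ih, Sym2.eq_swap]

lemma mem_of_mem_pathEdges {l : List V} {e : Sym2 V} (he : e ∈ pathEdges l) {v : V} (hv : v ∈ e) :
    v ∈ l := by
  induction l with
  | nil => simp at he
  | cons a l ih =>
    cases l with
    | nil => simp at he
    | cons b l =>
      simp only [pathEdges_cons_cons, Multiset.mem_cons] at he
      rcases he with rfl | he
      · rcases Sym2.mem_iff.1 hv with rfl | rfl <;> simp
      · exact List.mem_cons_of_mem _ (ih he)

lemma nodup_pathEdges {l : List V} (hl : l.Nodup) : (pathEdges l).Nodup := by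
  induction l with
  | nil => simp
  | cons a l ih =>
    cases l with
    | nil => simp
    | cons b l =>
      rw [pathEdges_cons_cons, Multiset.nodup_cons]
      refine ⟨fun h => ?_, ih hl.of_cons⟩
      exact (List.nodup_cons.1 hl).1 (mem_of_mem_pathEdges h (Sym2.mem_mk_left a b))

/-- `v` is an end of some edge in `M`. -/
def Touches (M : Multiset (Sym2 V)) (v : V) : Prop := ∃ e ∈ M, v ∈ e

@[simp] lemma not_touches_zero (v : V) : ¬ Touches 0 v := by simp [Touches]

@[simp] lemma touches_cons (e : Sym2 V) (M : Multiset (Sym2 V)) (v : V) :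
    Touches (e ::ₘ M) v ↔ v ∈ e ∨ Touches M v := by simp [Touches]

@[simp] lemma touches_singleton (e : Sym2 V) (v : V) : Touches {e} v ↔ v ∈ e := by
  simp [Touches]

@[simp] lemma touches_add (M N : Multiset (Sym2 V)) (v : V) :
    Touches (M + N) v ↔ Touches M v ∨ Touches N v := by
  simp [Touches, or_and_right, exists_or]

lemma Touches.mem {l : List V} {v : V} (h : Touches (pathEdges l) v) : v ∈ l :=
  let ⟨_, he, hv⟩ := h; mem_of_mem_pathEdges he hv

/-- The edge `e` excludes a one-vertex list, which touches nothing. -/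
lemma touches_pathEdges_of_mem {l : List V} {v : V} (hv : v ∈ l) {e : Sym2 V}
    (he : e ∈ pathEdges l) : Touches (pathEdges l) v := by
  obtain ⟨l₁, l₂, rfl⟩ := List.append_of_mem hv
  rw [pathEdges_append_cons, touches_add]
  cases l₂ with
  | cons b l₂ => right; simp
  | nil =>
    left
    rcases List.eq_nil_or_concat' l₁ with rfl | ⟨l₁, b, rfl⟩
    · simp at he
    · rw [List.append_assoc, List.singleton_append, pathEdges_concat]; simp

/-- `M` is the sum of the edge multisets of at most `k` paths. -/
def Decomposes (M : Multiset (Sym2 V)) (k : ℕ) : Prop :=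
  ∃ L : List (List V), (∀ l ∈ L, l.Nodup) ∧ (L.map pathEdges).sum = M ∧ L.length ≤ k

lemma Decomposes.mono {M : Multiset (Sym2 V)} {j k : ℕ} (h : Decomposes M j) (hjk : j ≤ k) :
    Decomposes M k := let ⟨L, h₁, h₂, h₃⟩ := h; ⟨L, h₁, h₂, h₃.trans hjk⟩

lemma decomposes_path {l : List V} (hl : l.Nodup) : Decomposes (pathEdges l) 1 :=
  ⟨[l], by simpa using hl, by simp, by simp⟩

lemma Decomposes.add {M N : Multiset (Sym2 V)} {j k : ℕ} (hM : Decomposes M j)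
    (hN : Decomposes N k) : Decomposes (M + N) (j + k) := by
  obtain ⟨L, h₁, h₂, h₃⟩ := hM
  obtain ⟨L', h₁', h₂', h₃'⟩ := hN
  refine ⟨L ++ L', ?_, by simp [h₂, h₂'], by simp; omega⟩
  intro l hl
  rcases List.mem_append.1 hl with h | h
  exacts [h₁ l h, h₁' l h]

lemma decomposes_two_paths {l l' : List V} (hl : l.Nodup) (hl' : l'.Nodup) :
    Decomposes (pathEdges l + pathEdges l') 2 := (decomposes_path hl).add (decomposes_path hl')

/-- In a decomposition, one path satisfying a property inherited from the edge multiset can be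
singled out. -/
lemma Decomposes.exists_split {M : Multiset (Sym2 V)} {k : ℕ} (h : Decomposes M k)
    (p : Multiset (Sym2 V) → Prop) (hp0 : ¬ p 0) (hp : ∀ A B, p (A + B) → p A ∨ p B) (hM : p M) :
    ∃ (l : List V) (N : Multiset (Sym2 V)) (j : ℕ), l.Nodup ∧ p (pathEdges l) ∧
      M = pathEdges l + N ∧ Decomposes N j ∧ j + 1 ≤ k := by
  obtain ⟨L, h₁, h₂, h₃⟩ := h
  have key : ∃ l ∈ L, p (pathEdges l) := by
    clear h₁ h₃
    induction L generalizing M with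
    | nil => simp at h₂; subst h₂; exact absurd hM hp0
    | cons l L ih =>
      subst h₂
      rw [List.map_cons, List.sum_cons] at hM
      rcases hp _ _ hM with h | h
      · exact ⟨l, by simp, h⟩
      · obtain ⟨l', hl', h'⟩ := ih h rfl
        exact ⟨l', List.mem_cons_of_mem _ hl', h'⟩
  obtain ⟨l, hl, hpl⟩ := key
  obtain ⟨L₁, L₂, rfl⟩ := List.append_of_mem hl
  refine ⟨l, ((L₁ ++ L₂).map pathEdges).sum, (L₁ ++ L₂).length, h₁ l hl, hpl, ?_,
    ⟨L₁ ++ L₂, fun l' hl' => h₁ l' ?_, rfl, le_rfl⟩, ?_⟩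
  · rw [← h₂]; simp [add_left_comm]
  · simp at hl' ⊢; tauto
  · simp at h₃ ⊢; omega

/-- A cycle `u, p, a, t` all of whose vertices other than `u` and `a` are fresh can be absorbed at
the cost of one path, if `u` is touched. -/
lemma Decomposes.absorb_cycle {M : Multiset (Sym2 V)} {k : ℕ} (h : Decomposes M k) {u a t : V}
    {p : List V} (hu : Touches M u) (hua : u ≠ a) (htp : (t :: p).Nodup)
    (hfresh : ∀ v ∈ t :: p, ¬ Touches M v) (ha : a ∉ t :: p) :
    Decomposes (s(a, t) ::ₘ s(t, u) ::ₘ pathEdges (u :: (p ++ [a])) + M) (k + 1) := by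
  obtain ⟨l, N, j, hl, hul, rfl, hN, hj⟩ := h.exists_split (fun A => Touches A u) (by simp)
    (by simp) hu
  have hfl : ∀ v ∈ t :: p, v ∉ l := fun v hv hvl => by
    obtain ⟨e, he, -⟩ := hul
    exact hfresh v hv (touches_add _ _ _ |>.2 (Or.inl (touches_pathEdges_of_mem hvl he)))
  have htl := hfl t (by simp)
  have hpl : ∀ v ∈ p, v ∉ l := fun v hv => hfl v (by simp [hv])
  have hul' := hul.mem
  suffices H : Decomposes (s(a, t) ::ₘ s(t, u) ::ₘ pathEdges (u :: (p ++ [a])) + pathEdges l) 2 by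
    rw [← add_assoc]
    exact (H.add hN).mono (by omega)
  clear hul hfresh hfl hu hN hj N h
  have htp' := List.nodup_cons.1 htp
  have hat : a ≠ t := fun h => ha (by simp [h])
  have hap : a ∉ p := fun h => ha (by simp [h])
  by_cases hal : a ∈ l
  -- If the path also meets `a`, it reads l₁ u m a l₃ up to reversal. The new paths are l₁ u m a t
  -- and t u p a l₃: each follows one of the two routes from `u` to `a`, and the fresh `t` ends one
  -- and starts the other.
  · have main : ∀ l₁ m l₃ : List V, (l₁ ++ u :: (m ++ a :: l₃)).Nodup →
        t ∉ (l₁ ++ u :: (m ++ a :: l₃)) → (∀ v ∈ p, v ∉ (l₁ ++ u :: (m ++ a :: l₃))) →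
        Decomposes (s(a, t) ::ₘ s(t, u) ::ₘ pathEdges (u :: (p ++ [a])) +
          pathEdges (l₁ ++ u :: (m ++ a :: l₃))) 2 := by
      intro l₁ m l₃ hn ht hp
      have e : s(a, t) ::ₘ s(t, u) ::ₘ pathEdges (u :: (p ++ [a])) +
          pathEdges (l₁ ++ u :: (m ++ a :: l₃)) =
          pathEdges ((l₁ ++ u :: m) ++ [a, t]) + pathEdges (t :: u :: (p ++ a :: l₃)) := by
        rw [pathEdges_concat, pathEdges_cons_cons,
          show u :: (p ++ a :: l₃) = (u :: p) ++ a :: l₃ by simp, pathEdges_append_cons (u :: p),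
          show l₁ ++ u :: (m ++ a :: l₃) = (l₁ ++ u :: m) ++ a :: l₃ by simp,
          pathEdges_append_cons (l₁ ++ u :: m)]
        simp only [← Multiset.singleton_add, List.cons_append]
        abel
      rw [e]
      refine decomposes_two_paths ?_ ?_
      · simp only [List.nodup_append, List.nodup_cons, List.mem_append, List.mem_cons] at hn ht ⊢
        grind
      · simp only [List.nodup_append, List.nodup_cons, List.mem_append, List.mem_cons] at hn ht hp ⊢
        grind
    obtain ⟨l₁, l₂, rfl⟩ := List.append_of_mem hul'
    have h' : a ∈ l₁ ∨ a ∈ l₂ := by simp [hua.symm] at hal; exact hal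
    rcases h' with h' | h'
    · obtain ⟨l₀, m, rfl⟩ := List.append_of_mem h'
      have hr : ((l₀ ++ a :: m) ++ u :: l₂).reverse =
        l₂.reverse ++ u :: (m.reverse ++ a :: l₀.reverse) := by simp
      rw [← pathEdges_reverse (l₀ ++ a :: m ++ u :: l₂), hr]
      apply main
      · rw [← hr]; exact List.nodup_reverse.2 hl
      · rw [← hr]; simp at htl ⊢; tauto
      · rw [← hr]; intro v hv; have := hpl v hv; simp at this ⊢; tauto
    · obtain ⟨m, l₃, rfl⟩ := List.append_of_mem h'
      exact main _ _ _ hl htl hpl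
  · obtain ⟨l₁, l₂, rfl⟩ := List.append_of_mem hul'
    -- If the path misses `a`, it is cut at `u`: one half goes around the cycle as l₁ u p a t, the
    -- other becomes t u l₂.
    have e : s(a, t) ::ₘ s(t, u) ::ₘ pathEdges (u :: (p ++ [a])) + pathEdges (l₁ ++ u :: l₂) =
        pathEdges ((l₁ ++ u :: p) ++ [a, t]) + pathEdges (t :: u :: l₂) := by
      rw [pathEdges_concat, pathEdges_cons_cons, pathEdges_append_cons,
        show (l₁ ++ u :: p) ++ [a] = l₁ ++ u :: (p ++ [a]) by simp, pathEdges_append_cons l₁ u (p ++ [a])]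
      simp only [← Multiset.singleton_add]
      abel
    rw [e]
    refine decomposes_two_paths ?_ ?_
    · simp only [List.nodup_append, List.nodup_cons, List.mem_append, List.mem_cons] at *
      grind
    · simp only [List.nodup_append, List.nodup_cons, List.mem_append, List.mem_cons] at *
      grind

/-! ### Degrees and ends of paths -/

variable [DecidableEq V]

/-- The number of edges of `M` at `v`. -/
def degree (M : Multiset (Sym2 V)) (v : V) : ℕ := M.countP (v ∈ ·)

@[simp] lemma degree_zero (v : V) : degree 0 v = 0 := rfl

@[simp] lemma degree_add (M N : Multiset (Sym2 V)) (v : V) :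
    degree (M + N) v = degree M v + degree N v := Multiset.countP_add _ _ _

@[simp] lemma degree_cons (e : Sym2 V) (M : Multiset (Sym2 V)) (v : V) :
    degree (e ::ₘ M) v = degree M v + if v ∈ e then 1 else 0 := Multiset.countP_cons _ _ _

@[simp] lemma degree_singleton (e : Sym2 V) (v : V) :
    degree {e} v = if v ∈ e then 1 else 0 := by
  rw [← Multiset.cons_zero, degree_cons, degree_zero, zero_add]

lemma degree_eq_zero {M : Multiset (Sym2 V)} {v : V} : degree M v = 0 ↔ ¬ Touches M v := by
  rw [degree, Multiset.countP_eq_zero]; simp [Touches]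

lemma degree_pathEdges_eq_zero {l : List V} {v : V} (h : v ∉ l) : degree (pathEdges l) v = 0 :=
  degree_eq_zero.2 fun h' => h h'.mem

lemma degree_pathEdges_head {a b : V} {l : List V} (h : (a :: b :: l).Nodup) :
    degree (pathEdges (a :: b :: l)) a = 1 := by
  rw [pathEdges_cons_cons, degree_cons, degree_pathEdges_eq_zero (List.nodup_cons.1 h).1]
  simp

/-- The degree of a path is two at an inner vertex and zero off the path. -/
lemma eq_cons_or_eq_concat_of_odd_degree {l : List V} (hl : l.Nodup) {v : V}
    (h : Odd (degree (pathEdges l) v)) : (∃ l', l = v :: l') ∨ ∃ l', l = l' ++ [v] := by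
  by_cases hv : v ∈ l
  swap
  · rw [degree_pathEdges_eq_zero hv] at h; simp at h
  obtain ⟨l₁, l₂, rfl⟩ := List.append_of_mem hv
  rcases List.eq_nil_or_concat' l₁ with rfl | ⟨l₁, b, rfl⟩
  · left; simp
  cases l₂ with
  | nil => right; exact ⟨_, rfl⟩
  | cons c l₂ =>
    exfalso
    rw [List.append_assoc, List.singleton_append, pathEdges_append_cons] at h
    simp only [List.append_assoc, List.singleton_append, List.nodup_append, List.nodup_cons,
      List.mem_cons] at hl
    rw [degree_add, pathEdges_cons_cons, pathEdges_cons_cons, degree_cons, degree_cons,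
      degree_pathEdges_eq_zero (by simp; grind), degree_pathEdges_eq_zero (by simp; grind)] at h
    simp at h
    exact absurd h (by decide)

/-- At a vertex of odd degree, some path of the decomposition ends and can be extended by fresh
vertices. -/
lemma Decomposes.extend {M : Multiset (Sym2 V)} {k : ℕ} (h : Decomposes M k) {v : V} {t : List V}
    (hodd : Odd (degree M v)) (ht : (v :: t).Nodup) (hfresh : ∀ w ∈ t, ¬ Touches M w) :
    Decomposes (pathEdges (v :: t) + M) k := by
  obtain ⟨l, N, j, hl, hv, rfl, hN, hj⟩ := h.exists_split (fun A => Odd (degree A v)) (by simp)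
    (fun A B h => by
      rw [degree_add] at h
      by_contra! hc
      rw [Nat.not_odd_iff_even, Nat.not_odd_iff_even] at hc
      exact Nat.not_odd_iff_even.2 (hc.1.add hc.2) h) hodd
  have hfl : ∀ w ∈ t, w ∉ l := fun w hw hwl => by
    have : Touches (pathEdges l) v := by
      by_contra hc; rw [← degree_eq_zero] at hc; rw [hc] at hv; simp at hv
    obtain ⟨e, he, -⟩ := this
    exact hfresh w hw (touches_add _ _ _ |>.2 (Or.inl (touches_pathEdges_of_mem hwl he)))
  obtain ⟨l', hl', hle, hfl'⟩ : ∃ l', (l' ++ [v]).Nodup ∧ pathEdges l = pathEdges (l' ++ [v]) ∧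
      ∀ w ∈ t, w ∉ l' := by
    rcases eq_cons_or_eq_concat_of_odd_degree hl hv with ⟨l', rfl⟩ | ⟨l', rfl⟩
    · exact ⟨l'.reverse, by rw [← List.reverse_cons]; exact List.nodup_reverse.2 hl,
        by rw [← List.reverse_cons, pathEdges_reverse],
        fun w hw hw' => hfl w hw (by simp at hw'; simp [hw'])⟩
    · exact ⟨l', hl, rfl, fun w hw hw' => hfl w hw (by simp [hw'])⟩
  have : Decomposes (pathEdges (l' ++ v :: t)) 1 := by
    apply decomposes_path
    simp only [List.nodup_append, List.nodup_cons, List.mem_cons] at hl' ht ⊢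
    grind
  rw [pathEdges_append_cons] at this
  rw [hle, ← add_assoc, add_comm (pathEdges (v :: t))]
  exact (this.add hN).mono (by omega)

end PathDecomposition

/-! ### Triangle components, the deletion step, and bridges -/

namespace PathDecomposition

variable {V : Type*}

/-- An edge set on the vertex set `W` without loops in which every nonempty vertex set has a
vertex with at most two neighbours in that set. -/
structure IsSparse [DecidableEq V] (W : Finset V) (E : Finset (Sym2 V)) : Prop where
  loopless : ∀ v, s(v, v) ∉ E
  support : ∀ e ∈ E, ∀ v ∈ e, v ∈ W
  sparse : ∀ S : Finset V, S.Nonempty → ∃ v ∈ S, (S.filter fun w => s(v, w) ∈ E).card ≤ 2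

lemma IsSparse.mono [DecidableEq V] {W W' : Finset V} {E E' : Finset (Sym2 V)} (h : IsSparse W E) (hE : E' ⊆ E)
    (hW' : ∀ e ∈ E', ∀ v ∈ e, v ∈ W') : IsSparse W' E' where
  loopless v hv := h.loopless v (hE hv)
  support := hW'
  sparse S hS := by
    obtain ⟨v, hv, hc⟩ := h.sparse S hS
    exact ⟨v, hv, (Finset.card_le_card (Finset.monotone_filter_right S
      fun w _ hw => hE hw)).trans hc⟩

/-- `a`, `b`, `c` are the vertices of a connected component that is a triangle. -/
structure IsTriangleComponent (E : Finset (Sym2 V)) (a b c : V) : Prop where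
  mem₁ : s(a, b) ∈ E
  mem₂ : s(b, c) ∈ E
  mem₃ : s(c, a) ∈ E
  closed : ∀ e ∈ E, a ∈ e ∨ b ∈ e ∨ c ∈ e → e = s(a, b) ∨ e = s(b, c) ∨ e = s(c, a)

lemma IsTriangleComponent.rotate {E : Finset (Sym2 V)} {a b c : V}
    (h : IsTriangleComponent E a b c) : IsTriangleComponent E b c a :=
  ⟨h.mem₂, h.mem₃, h.mem₁, fun e he hv => by have := h.closed e he (by tauto); tauto⟩

lemma IsTriangleComponent.swap {E : Finset (Sym2 V)} {a b c : V}
    (h : IsTriangleComponent E a b c) : IsTriangleComponent E b a c :=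
  ⟨by rw [Sym2.eq_swap]; exact h.mem₁, by rw [Sym2.eq_swap]; exact h.mem₃,
    by rw [Sym2.eq_swap]; exact h.mem₂, fun e he hv => by
      rcases h.closed e he (by tauto) with h' | h' | h' <;> rw [h', Sym2.eq_swap] <;> simp⟩

variable [DecidableEq V]

lemma IsTriangleComponent.distinct {W : Finset V} {E : Finset (Sym2 V)} {a b c : V}
    (h : IsTriangleComponent E a b c) (hE : IsSparse W E) : a ≠ b ∧ b ≠ c ∧ a ≠ c := by
  refine ⟨?_, ?_, ?_⟩ <;> rintro rfl
  exacts [hE.loopless _ h.mem₁, hE.loopless _ h.mem₂, hE.loopless _ h.mem₃]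

lemma val_eq_add_filter {E : Finset (Sym2 V)} {X : Multiset (Sym2 V)} (hX : X.Nodup)
    (hXE : ∀ e ∈ X, e ∈ E) : E.val = X + (E.filter (· ∉ X)).val := by
  rw [Finset.filter_val, ← Multiset.filter_add_not (· ∈ X) E.val]
  congr 1
  · refine (Multiset.Nodup.ext (E.nodup.filter _) hX).2 fun e => ?_
    simp only [Multiset.mem_filter, Finset.mem_val]
    exact ⟨fun h => h.2, fun h => ⟨hXE e h, h⟩⟩
  · simp

/-- Every triangle-component-free sparse edge set on fewer than `n` vertices decomposes into at
most half as many paths as it has vertices. -/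
def HoldsBelow (V : Type*) [DecidableEq V] (n : ℕ) : Prop :=
  ∀ (W : Finset V) (E : Finset (Sym2 V)), W.card < n → IsSparse W E →
    (∀ a b c, ¬ IsTriangleComponent E a b c) → Decomposes E.val (W.card / 2)

/-- Triangle components can be deleted, the rest decomposed, and the triangles absorbed
afterwards, as long as each of them shares one or two vertices with the additional edges. -/
lemma HoldsBelow.exists_triangleFree_part {n : ℕ} (ih : HoldsBelow V n) {W : Finset V}
    {E : Finset (Sym2 V)} (hW : W.card < n) (hE : IsSparse W E) :
    ∃ E₀ ⊆ E, ∃ j, Decomposes E₀.val j ∧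
      (∀ v, degree E₀.val v = degree E.val v ∨ ∃ b c, IsTriangleComponent E v b c) ∧
      ∀ (X : Multiset (Sym2 V)) (k : ℕ), (∀ a b c, IsTriangleComponent E a b c →
        (Touches X a ∨ Touches X b ∨ Touches X c) ∧
          ¬ (Touches X a ∧ Touches X b ∧ Touches X c)) →
        Decomposes (X + E₀.val) (k + j) → Decomposes (X + E.val) (k + W.card / 2) := by
  induction hm : W.card using Nat.strong_induction_on generalizing W E with
  | _ m ihm =>
  by_cases hT : ∀ a b c, ¬ IsTriangleComponent E a b c
  · exact ⟨E, subset_rfl, W.card / 2, ih W E hW hE hT, fun v => Or.inl rfl,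
      fun X k _ h => hm ▸ h⟩
  push Not at hT
  obtain ⟨a, b, c, hT⟩ := hT
  obtain ⟨hab, hbc, hac⟩ := hT.distinct hE
  set T : Multiset (Sym2 V) := {s(a, b), s(b, c), s(c, a)} with hTdef
  have hTn : T.Nodup := by simp [hTdef]; grind
  have hTE : ∀ e ∈ T, e ∈ E := by
    intro e he
    simp only [hTdef, Multiset.insert_eq_cons, Multiset.mem_cons, Multiset.mem_singleton] at he
    rcases he with rfl | rfl | rfl
    exacts [hT.mem₁, hT.mem₂, hT.mem₃]
  have hsplit := val_eq_add_filter hTn hTE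
  set E₁ := E.filter (· ∉ T) with hE₁
  have hE₁T : ∀ e ∈ E₁, a ∉ e ∧ b ∉ e ∧ c ∉ e := by
    intro e he
    rw [hE₁, Finset.mem_filter] at he
    by_contra hc
    exact he.2 (by simpa [hTdef] using hT.closed e he.1 (by tauto))
  set W₁ := W \ {a, b, c} with hW₁
  have haW := hE.support _ hT.mem₁ a (by simp)
  have hbW := hE.support _ hT.mem₁ b (by simp)
  have hcW := hE.support _ hT.mem₂ c (by simp)
  have hcard : W₁.card + 3 = W.card := by
    have h3 : ({a, b, c} : Finset V).card = 3 := Finset.card_eq_three.2 ⟨a, b, c, hab, hac, hbc, rfl⟩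
    rw [hW₁, ← h3]
    refine Finset.card_sdiff_add_card_eq_card ?_
    intro v; simp only [Finset.mem_insert, Finset.mem_singleton]
    rintro (rfl | rfl | rfl) <;> assumption
  have hsp₁ : IsSparse W₁ E₁ := hE.mono (Finset.filter_subset _ _) fun e he v hv => by
    rw [hW₁, Finset.mem_sdiff]
    refine ⟨hE.support e (Finset.filter_subset _ _ he) v hv, ?_⟩
    have := hE₁T e he
    simp only [Finset.mem_insert, Finset.mem_singleton]
    rintro (rfl | rfl | rfl) <;> tauto
  have hlift : ∀ x y z, IsTriangleComponent E₁ x y z → IsTriangleComponent E x y z := by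
    intro x y z h
    refine ⟨Finset.filter_subset _ _ h.mem₁, Finset.filter_subset _ _ h.mem₂,
      Finset.filter_subset _ _ h.mem₃, fun e he hv => h.closed e ?_ hv⟩
    rw [hE₁, Finset.mem_filter]
    refine ⟨he, fun heT => ?_⟩
    have h₁ := hE₁T _ h.mem₁
    have h₂ := hE₁T _ h.mem₂
    simp only [hTdef, Multiset.insert_eq_cons, Multiset.mem_cons, Multiset.mem_singleton] at heT
    simp only [Sym2.mem_iff, not_or] at h₁ h₂
    rcases heT with rfl | rfl | rfl <;> simp only [Sym2.mem_iff] at hv <;> grind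
  obtain ⟨E₀, hE₀, j, hdec, hdeg, hX⟩ := ihm W₁.card (by omega) (by omega) hsp₁ rfl
  refine ⟨E₀, hE₀.trans (Finset.filter_subset _ _), j, hdec, fun v => ?_, fun X k hXT hXd => ?_⟩
  · by_cases hv : v = a ∨ v = b ∨ v = c
    · right
      rcases hv with rfl | rfl | rfl
      exacts [⟨_, _, hT⟩, ⟨_, _, hT.rotate⟩, ⟨_, _, hT.rotate.rotate⟩]
    · push Not at hv
      rcases hdeg v with h | ⟨x, y, h⟩
      · left
        rw [h, hsplit, degree_add]
        simp [hTdef, hv]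
      · exact Or.inr ⟨x, y, hlift _ _ _ h⟩
  · have h₁ := hX X k (fun x y z h => hXT x y z (hlift x y z h)) hXd
    obtain ⟨ht, hnt⟩ := hXT a b c hT
    have hno : ∀ v, v = a ∨ v = b ∨ v = c → ¬ Touches E₁.val v := by
      rintro v hv ⟨e, he, hve⟩
      have := hE₁T e he
      rcases hv with rfl | rfl | rfl <;> tauto
    -- The triangle is absorbed at a touched vertex `u`, with an untouched vertex `t` as the fresh
    -- one; the third vertex `x` may be either. No further fresh vertices are needed, so `p` is
    -- empty.
    have key : ∀ u x t, u ≠ x → t ≠ u → t ≠ x → (t = a ∨ t = b ∨ t = c) → Touches X u →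
        ¬ Touches X t → T = {s(x, t), s(t, u), s(u, x)} →
        Decomposes (X + E.val) (k + m / 2) := by
      intro u x t hux htu htx htT hu htX hTe
      have := h₁.absorb_cycle (u := u) (a := x) (t := t) (p := []) (by simp [hu]) hux (by simp)
        (by simp; exact ⟨htX, hno t htT⟩) (by simpa using htx.symm)
      -- Removing the triangle cost three vertices, and (m - 3) / 2 + 1 ≤ m / 2.
      have h := this.mono (by omega : _ ≤ k + m / 2)
      rw [hsplit, hTe]
      convert h using 1
      simp only [List.nil_append, pathEdges_cons_cons, pathEdges_singleton,
        Multiset.insert_eq_cons, ← Multiset.singleton_add]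
      abel
    have e₁ : T = {s(b, c), s(c, a), s(a, b)} := by
      simp only [hTdef, Multiset.insert_eq_cons, ← Multiset.singleton_add]; abel
    have e₂ : T = {s(c, a), s(a, b), s(b, c)} := by
      simp only [hTdef, Multiset.insert_eq_cons, ← Multiset.singleton_add]; abel
    have e₃ : T = {s(a, c), s(c, b), s(b, a)} := by
      rw [hTdef, Sym2.eq_swap (a := a) (b := c), Sym2.eq_swap (a := c) (b := b),
        Sym2.eq_swap (a := b) (b := a)]
      simp only [Multiset.insert_eq_cons, ← Multiset.singleton_add]; abel
    have e₄ : T = {s(b, a), s(a, c), s(c, b)} := by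
      rw [e₃]; simp only [Multiset.insert_eq_cons, ← Multiset.singleton_add]; abel
    have e₅ : T = {s(c, b), s(b, a), s(a, c)} := by
      rw [e₃]; simp only [Multiset.insert_eq_cons, ← Multiset.singleton_add]; abel
    by_cases ha : Touches X a <;> by_cases hb : Touches X b <;> by_cases hc : Touches X c
    · tauto
    · exact key a b c hab hac.symm hbc.symm (by tauto) ha hc e₁
    · exact key a c b hac hab.symm hbc (by tauto) ha hb e₅
    · exact key a b c hab hac.symm hbc.symm (by tauto) ha hc e₁
    · exact key b c a hbc hab hac (by tauto) hb ha e₂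
    · exact key b c a hbc hab hac (by tauto) hb ha e₂
    · exact key c b a hbc.symm hac hab (by tauto) hc ha e₄
    · tauto

/-- The induction step: the vertices in `C` and the edges in `X` are deleted. -/
lemma HoldsBelow.of_delete {W : Finset V} (ih : HoldsBelow V W.card) {E : Finset (Sym2 V)}
    (hE : IsSparse W E) (hT : ∀ a b c, ¬ IsTriangleComponent E a b c) (C : Finset V)
    (hCW : C ⊆ W) (hC : C.Nonempty) (X : Multiset (Sym2 V)) (hX : X.Nodup)
    (hXE : ∀ e ∈ X, e ∈ E) (hCX : ∀ e ∈ E, ∀ v ∈ e, v ∈ C → e ∈ X) {k : ℕ}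
    (hk : k + (W.card - C.card) / 2 ≤ W.card / 2)
    (htouch : ∀ a b c, IsTriangleComponent (E.filter (· ∉ X)) a b c → a ∉ C → b ∉ C → c ∉ C →
      a ≠ b → b ≠ c → a ≠ c → Touches X a → Touches X b → Touches X c → False)
    (hdec : ∀ M j, Decomposes M j → M ≤ (E.filter (· ∉ X)).val →
      (∀ v, degree M v = degree (E.filter (· ∉ X)).val v ∨
        ∃ b c, IsTriangleComponent (E.filter (· ∉ X)) v b c) → Decomposes (X + M) (k + j)) :
    Decomposes E.val (W.card / 2) := by
  have hsplit := val_eq_add_filter hX hXE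
  have hcard := Finset.card_sdiff_add_card_eq_card hCW
  have hCpos := hC.card_pos
  have hR : IsSparse (W \ C) (E.filter (· ∉ X)) := hE.mono (Finset.filter_subset _ _)
    fun e he v hv => by
      rw [Finset.mem_filter] at he
      exact Finset.mem_sdiff.2 ⟨hE.support e he.1 v hv, fun h => he.2 (hCX e he.1 v hv h)⟩
  obtain ⟨E₀, hE₀, j, h₁, h₂, h₃⟩ := ih.exists_triangleFree_part (by omega) hR
  rw [hsplit]
  refine (h₃ X k (fun a b c h => ⟨?_, ?_⟩)
    (hdec _ _ h₁ (Finset.val_le_iff.2 hE₀) h₂)).mono (by omega)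
  -- A triangle that `X` does not touch would already be a component of `E`.
  · by_contra! hc
    refine hT a b c ⟨Finset.filter_subset _ _ h.mem₁, Finset.filter_subset _ _ h.mem₂,
      Finset.filter_subset _ _ h.mem₃, fun e he hv => h.closed e ?_ hv⟩
    rw [Finset.mem_filter]
    refine ⟨he, fun heX => ?_⟩
    rcases hv with hv | hv | hv
    exacts [hc.1 ⟨e, heX, hv⟩, hc.2.1 ⟨e, heX, hv⟩, hc.2.2 ⟨e, heX, hv⟩]
  · rintro ⟨ha, hb, hc⟩
    obtain ⟨d₁, d₂, d₃⟩ := h.distinct hR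
    have hn : ∀ v, (∃ e ∈ E.filter (· ∉ X), v ∈ e) → v ∉ C := fun v ⟨e, he, hv⟩ =>
      (Finset.mem_sdiff.1 (hR.support e he v hv)).2
    exact htouch a b c h (hn a ⟨_, h.mem₁, by simp⟩) (hn b ⟨_, h.mem₁, by simp⟩)
      (hn c ⟨_, h.mem₂, by simp⟩) d₁ d₂ d₃ ha hb hc

/-- The induction step in which the deleted edges are decomposed separately. -/
lemma HoldsBelow.of_delete_decomposes {W : Finset V} (ih : HoldsBelow V W.card)
    {E : Finset (Sym2 V)}
    (hE : IsSparse W E) (hT : ∀ a b c, ¬ IsTriangleComponent E a b c) (C : Finset V)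
    (hCW : C ⊆ W) (hC : C.Nonempty) (X : Multiset (Sym2 V)) (hX : X.Nodup)
    (hXE : ∀ e ∈ X, e ∈ E) (hCX : ∀ e ∈ E, ∀ v ∈ e, v ∈ C → e ∈ X) {k : ℕ}
    (hk : k + (W.card - C.card) / 2 ≤ W.card / 2) (hdec : Decomposes X k)
    (htouch : ∀ a b c, a ∉ C → b ∉ C → c ∉ C → a ≠ b → b ≠ c → a ≠ c →
      Touches X a → Touches X b → Touches X c → False) :
    Decomposes E.val (W.card / 2) :=
  ih.of_delete hE hT C hCW hC X hX hXE hCX hk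
    (fun a b c _ => htouch a b c) fun _ _ hM _ _ => hdec.add hM

/-- The induction step at a bridge `xu` with an even number of vertices on the side of `x`. -/
lemma HoldsBelow.of_bridge {W : Finset V} (ih : HoldsBelow V W.card) {E : Finset (Sym2 V)}
    (hE : IsSparse W E) (hT : ∀ a b c, ¬ IsTriangleComponent E a b c) {A : Finset V} (hA : A ⊆ W)
    (heven : Even A.card) (hW : Odd W.card) (hcard : A.card + 1 < W.card) {x u : V} (hx : x ∈ A)
    (hu : u ∉ A) (hxu : s(x, u) ∈ E)
    (hb : ∀ e ∈ E, e ≠ s(x, u) → ∀ v ∈ e, ∀ w ∈ e, v ∈ A → w ∈ A) :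
    Decomposes E.val (W.card / 2) := by
  classical
  set F := E.filter (fun e => ∃ v ∈ e, v ∈ A) with hF
  have hFu : ∀ e ∈ F, e ≠ s(x, u) → ∀ v ∈ e, v ∈ A := fun e he hne v hv => by
    obtain ⟨he, w, hw, hwA⟩ := Finset.mem_filter.1 he
    exact hb e he hne w hw v hv hwA
  have hFA : ∀ e ∈ F, ∀ v ∈ e, v ∈ A ∨ v = u := fun e he v hv => by
    by_cases hne : e = s(x, u)
    · subst hne
      rcases Sym2.mem_iff.1 hv with rfl | rfl
      exacts [Or.inl hx, Or.inr rfl]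
    · exact Or.inl (hFu e he hne v hv)
  have hFs : IsSparse (insert u A) F := hE.mono (Finset.filter_subset _ _) fun e he v hv => by
    rw [Finset.mem_insert]; exact (hFA e he v hv).symm
  have hFT : ∀ a b c, ¬ IsTriangleComponent F a b c := by
    intro a b c h
    have hd := h.distinct hFs
    -- The bridge is the only edge of `F` at `u`, so `u` lies in no triangle of `F`; a triangle
    -- component of `F` then lies inside `A` and is one of `E`.
    have hnu : ∀ b c, b ≠ c → s(u, b) ∈ F → s(c, u) ∈ F → False := by
      intro b c hbc h₁ h₂
      have e₁ : s(u, b) = s(x, u) := by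
        by_contra hne; exact hu (hFu _ h₁ hne u (by simp))
      have e₂ : s(c, u) = s(x, u) := by
        by_contra hne; exact hu (hFu _ h₂ hne u (by simp))
      rw [Sym2.eq_iff] at e₁ e₂
      have : x ≠ u := fun h => hu (h ▸ hx)
      grind
    have h₁ : ∀ v, (v = a ∨ v = b ∨ v = c) → v ∈ A := by
      rintro v hv
      have hvu : v ≠ u := by
        rintro rfl
        rcases hv with rfl | rfl | rfl
        exacts [hnu b c hd.2.1 h.mem₁ h.mem₃, hnu c a hd.2.2.symm h.mem₂ h.mem₁,
          hnu a b hd.1 h.mem₃ h.mem₂]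
      have : v ∈ A ∨ v = u := by
        rcases hv with rfl | rfl | rfl
        exacts [hFA _ h.mem₁ v (by simp), hFA _ h.mem₂ v (by simp), hFA _ h.mem₃ v (by simp)]
      tauto
    refine hT a b c ⟨Finset.filter_subset _ _ h.mem₁, Finset.filter_subset _ _ h.mem₂,
      Finset.filter_subset _ _ h.mem₃, fun e he hv => h.closed e ?_ hv⟩
    rw [hF, Finset.mem_filter]
    refine ⟨he, ?_⟩
    rcases hv with hv | hv | hv
    exacts [⟨a, hv, h₁ a (by tauto)⟩, ⟨b, hv, h₁ b (by tauto)⟩, ⟨c, hv, h₁ c (by tauto)⟩]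
  have hc : (insert u A).card = A.card + 1 := Finset.card_insert_of_notMem hu
  have hdec := ih (insert u A) F (by omega) hFs hFT
  refine ih.of_delete_decomposes hE hT A hA ⟨x, hx⟩ F.val F.nodup
    (fun e he => Finset.filter_subset _ _ he)
    (fun e he v hv hvA => Finset.mem_filter.2 ⟨he, v, hv, hvA⟩) ?_ hdec ?_
  -- As |A| is even, the |A| + 1 vertices of the larger side cost only |A| / 2 paths, so counting
  -- `u` on both sides is harmless.
  · rw [hc]
    obtain ⟨i, hi⟩ := heven
    obtain ⟨j, hj⟩ := hW
    omega
  · rintro a b c ha hb - hab - - ⟨e, he, hae⟩ ⟨f, hf, hbf⟩ -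
    have := hFA e he a hae
    have := hFA f hf b hbf
    grind

end PathDecomposition

/-! ### Vertices of degree at most two: even order and pendant triangles -/

namespace PathDecomposition

variable {V : Type*} [DecidableEq V]

/-- `v` has at most two neighbours. -/
def IsLow (W : Finset V) (E : Finset (Sym2 V)) (v : V) : Prop :=
  (W.filter fun w => s(v, w) ∈ E).card ≤ 2

lemma IsSparse.ne {W : Finset V} {E : Finset (Sym2 V)} (hE : IsSparse W E) {v w : V}
    (h : s(v, w) ∈ E) : v ≠ w := fun h' => hE.loopless v (by rwa [← h'] at h)

lemma IsSparse.mem_right {W : Finset V} {E : Finset (Sym2 V)} (hE : IsSparse W E) {v w : V}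
    (h : s(v, w) ∈ E) : w ∈ W := hE.support _ h w (by simp)

lemma IsSparse.mem_left {W : Finset V} {E : Finset (Sym2 V)} (hE : IsSparse W E) {v w : V}
    (h : s(v, w) ∈ E) : v ∈ W := hE.support _ h v (by simp)

lemma IsLow.neighbors {W : Finset V} {E : Finset (Sym2 V)} (hE : IsSparse W E) {v u : V}
    (hv : IsLow W E v) (hu : s(v, u) ∈ E) :
    (∀ w, s(v, w) ∈ E ↔ w = u) ∨ ∃ a, a ≠ u ∧ ∀ w, s(v, w) ∈ E ↔ w = u ∨ w = a := by
  have hmem : ∀ w, w ∈ (W.filter fun w => s(v, w) ∈ E) ↔ s(v, w) ∈ E := fun w => by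
    rw [Finset.mem_filter]; exact ⟨fun h => h.2, fun h => ⟨hE.mem_right h, h⟩⟩
  have hu' := (hmem u).2 hu
  have hc : ((W.filter fun w => s(v, w) ∈ E).erase u).card ≤ 1 := by
    rw [Finset.card_erase_of_mem hu']; unfold IsLow at hv; omega
  have : Nonempty V := ⟨v⟩
  rcases Finset.card_le_one_iff_subset_singleton (α := V) |>.1 hc with ⟨a, ha⟩
  rcases Finset.subset_singleton_iff.1 ha with h | h
  · left
    intro w
    rw [← hmem]
    have := Finset.ext_iff.1 h w
    simp only [Finset.mem_erase, Finset.notMem_empty, iff_false] at this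
    refine ⟨fun h => by by_contra hne; exact this ⟨hne, h⟩, fun h => h ▸ hu'⟩
  · right
    refine ⟨a, fun hau => ?_, fun w => ?_⟩
    · have := Finset.ext_iff.1 h u; simp [hau] at this
    · rw [← hmem]
      have := Finset.ext_iff.1 h w
      simp only [Finset.mem_erase, Finset.mem_singleton] at this
      constructor
      · intro h; by_cases hw : w = u
        exacts [Or.inl hw, Or.inr (this.1 ⟨hw, h⟩)]
      · rintro (rfl | h)
        exacts [hu', (this.2 h).2]

omit [DecidableEq V] in
lemma forall_edges_of_forall {E : Finset (Sym2 V)} {C : Finset V} {p : Sym2 V → Prop}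
    (h : ∀ v ∈ C, ∀ w, s(v, w) ∈ E → p s(v, w)) : ∀ e ∈ E, ∀ v ∈ e, v ∈ C → p e := by
  rintro e he v ⟨w, rfl⟩ hvC
  exact h v hvC w he

section Step

variable {W : Finset V} {E : Finset (Sym2 V)}

lemma HoldsBelow.of_isolated (ih : HoldsBelow V W.card) (hE : IsSparse W E)
    (hT : ∀ a b c, ¬ IsTriangleComponent E a b c) {v : V} (hv : v ∈ W)
    (h : ∀ w, s(v, w) ∉ E) : Decomposes E.val (W.card / 2) := by
  refine ih.of_delete_decomposes hE hT {v} (by simpa) (by simp) 0 (by simp) (by simp)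
    (forall_edges_of_forall (by simpa using h)) (k := 0) (by simp; omega)
    ⟨[], by simp, by simp, by simp⟩ (by simp)

/-- The edges at `v` form one path. It has at most two vertices besides `v`, so it cannot touch all
of a triangle in the rest. -/
lemma HoldsBelow.of_even (ih : HoldsBelow V W.card) (hE : IsSparse W E)
    (hT : ∀ a b c, ¬ IsTriangleComponent E a b c) (hW : Even W.card) {v : V} (hv : v ∈ W)
    (hl : IsLow W E v) : Decomposes E.val (W.card / 2) := by
  by_cases h : ∀ w, s(v, w) ∉ E
  · exact ih.of_isolated hE hT hv h
  push Not at h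
  obtain ⟨u, hu⟩ := h
  have hpos : 0 < W.card := Finset.card_pos.2 ⟨v, hv⟩
  have hcount : 1 + (W.card - 1) / 2 ≤ W.card / 2 := by obtain ⟨r, hr⟩ := hW; omega
  rcases hl.neighbors hE hu with h | ⟨a, hau, h⟩
  · have hn : [u, v].Nodup := by simpa using (hE.ne hu).symm
    refine ih.of_delete_decomposes hE hT {v} (by simpa) (by simp) (pathEdges [u, v])
      (nodup_pathEdges hn) (by simp [hu, Sym2.eq_swap (a := u)])
      (forall_edges_of_forall ?_) (k := 1) (by simpa using hcount) (decomposes_path hn) ?_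
    · intro x hx w hw
      obtain rfl := Finset.mem_singleton.1 hx
      rw [(h w).1 hw, Sym2.eq_swap]; simp
    · simp; grind
  · have hva := (h a).2 (Or.inr rfl)
    have hn : [u, v, a].Nodup := by
      have := hE.ne hu; have := hE.ne hva; simp; grind
    refine ih.of_delete_decomposes hE hT {v} (by simpa) (by simp) (pathEdges [u, v, a])
      (nodup_pathEdges hn) (by simp [hu, hva, Sym2.eq_swap (a := u)])
      (forall_edges_of_forall ?_) (k := 1) (by simpa using hcount) (decomposes_path hn) ?_
    · intro x hx w hw
      obtain rfl := Finset.mem_singleton.1 hx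
      rcases (h w).1 hw with rfl | rfl
      · rw [Sym2.eq_swap]; simp
      · simp
    · simp; grind

/-- Two deleted vertices pay for one path, whatever the parity of the order. -/
lemma card_insert_pair_le {a b : V} (ha : a ∈ W) (hb : b ∈ W) (hab : a ≠ b) :
    1 + (W.card - ({a, b} : Finset V).card) / 2 ≤ W.card / 2 := by
  have h : ({a, b} : Finset V) ⊆ W := by intro x; simp; rintro (rfl | rfl) <;> assumption
  have := Finset.card_le_card h
  rw [Finset.card_pair hab] at this ⊢
  omega

/-- A triangle two of whose vertices have no other neighbours. -/
lemma HoldsBelow.of_pendant_triangle (ih : HoldsBelow V W.card) (hE : IsSparse W E)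
    (hT : ∀ a b c, ¬ IsTriangleComponent E a b c) {u s t : V}
    (hs : ∀ w, s(s, w) ∈ E ↔ w = u ∨ w = t) (ht : ∀ w, s(t, w) ∈ E ↔ w = u ∨ w = s) :
    Decomposes E.val (W.card / 2) := by
  have hsu := (hs u).2 (Or.inl rfl)
  have htu := (ht u).2 (Or.inl rfl)
  have hst := (hs t).2 (Or.inr rfl)
  have dsu := hE.ne hsu
  have dtu := hE.ne htu
  have dst := hE.ne hst
  have mu := hE.mem_right hsu
  have ms := hE.mem_left hsu
  have mt := hE.mem_left htu
  set X : Multiset (Sym2 V) := {s(s, t), s(t, u), s(u, s)} with hXdef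
  have hXn : X.Nodup := by simp [hXdef]; grind
  have hXE : ∀ e ∈ X, e ∈ E := by
    simp [hXdef, hst, htu, Sym2.eq_swap (a := u), hsu]
  have hR : ∀ v w, s(v, w) ∈ E.filter (· ∉ X) → v ≠ s ∧ v ≠ t := by
    intro v w h
    rw [Finset.mem_filter] at h
    refine ⟨?_, ?_⟩ <;> rintro rfl
    · rcases (hs w).1 h.1 with rfl | rfl <;> exact h.2 (by simp [hXdef])
    · rcases (ht w).1 h.1 with rfl | rfl <;> exact h.2 (by simp [hXdef])
  have hR' : ∀ v w, s(v, w) ∈ E → s(v, w) ∈ X ∨ s(v, w) ∈ E.filter (· ∉ X) := by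
    intro v w h; rw [Finset.mem_filter]; tauto
  by_cases hu : ∃ p q, IsTriangleComponent (E.filter (· ∉ X)) u p q
  · obtain ⟨p, q, hpq⟩ := hu
    have d := hpq.distinct (hE.mono (Finset.filter_subset _ _)
      fun e he => hE.support e (Finset.filter_subset _ _ he))
    have hp := hR p q hpq.mem₂
    have hq := hR q u hpq.mem₃
    -- Two triangles sharing `u` form a whole component. Its five vertices pay for the two paths s t
    -- u p q and s u q.
    have n₁ : [s, t, u, p, q].Nodup := by simp; grind
    have n₂ : [s, u, q].Nodup := by simp; grind
    have e₁ := Finset.filter_subset _ _ hpq.mem₁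
    have e₂ := Finset.filter_subset _ _ hpq.mem₂
    have e₃ := Finset.filter_subset _ _ hpq.mem₃
    have hsub : ({s, t, u, p, q} : Finset V) ⊆ W := by
      intro x; simp only [Finset.mem_insert, Finset.mem_singleton]
      rintro (rfl | rfl | rfl | rfl | rfl)
      exacts [ms, mt, mu, hE.mem_right e₁, hE.mem_right e₂]
    have hcard : ({s, t, u, p, q} : Finset V).card = 5 := by
      simpa using List.toFinset_card_of_nodup n₁
    refine ih.of_delete_decomposes hE hT {s, t, u, p, q} hsub (by simp)
      (pathEdges [s, t, u, p, q] + pathEdges [s, u, q]) ?_ ?_ (forall_edges_of_forall ?_) (k := 2)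
      ?_ (decomposes_two_paths n₁ n₂) ?_
    · simp; grind
    · rw [Sym2.eq_swap] at e₃
      simp [hst, htu, e₁, e₂, e₃, hsu]
    · intro v hv w hw
      have := hR' v w hw
      have := hpq.closed s(v, w)
      have := hs w
      have := ht w
      simp only [hXdef, Multiset.insert_eq_cons, Multiset.mem_cons, Multiset.mem_singleton,
        Finset.mem_insert, Finset.mem_singleton, Sym2.mem_iff, Sym2.eq_iff, pathEdges_cons_cons,
        pathEdges_singleton, Multiset.mem_add, Multiset.notMem_zero] at *
      grind
    · have := Finset.card_le_card hsub
      rw [hcard] at this ⊢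
      omega
    · intro a b c ha hb hc hab hbc hac hta
      simp at ha hta
      grind
  -- Were `u` untouched by the rest, s t u would be a triangle component of `E`.
  · have hku : Touches (E.filter (· ∉ X)).val u := by
      by_contra hc
      refine hT s t u ⟨hst, htu, by rw [Sym2.eq_swap]; exact hsu, fun e he hv => ?_⟩
      by_contra hne
      have hemem : e ∈ E.filter (· ∉ X) := by
        rw [Finset.mem_filter]; exact ⟨he, by simpa [hXdef] using hne⟩
      rcases hv with ⟨w, rfl⟩ | ⟨w, rfl⟩ | hv
      · exact (hR _ _ hemem).1 rfl
      · exact (hR _ _ hemem).2 rfl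
      · exact hc ⟨e, hemem, hv⟩
    refine ih.of_delete hE hT {s, t} (by intro x; simp; rintro (rfl | rfl) <;> assumption)
      (by simp) X hXn hXE (forall_edges_of_forall ?_) (k := 1) (card_insert_pair_le ms mt dst) ?_ ?_
    · intro v hv w hw
      simp only [Finset.mem_insert, Finset.mem_singleton] at hv
      rcases hv with rfl | rfl
      · rcases (hs w).1 hw with rfl | rfl <;> simp [hXdef]
      · rcases (ht w).1 hw with rfl | rfl <;> simp [hXdef]
    · intro a b c _ ha hb hc hab hbc hac hta htb
      simp [hXdef] at ha hb hc hta htb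
      grind
    · intro M j hM hMR hdeg
      have hMu : Touches M u := by
        rcases hdeg u with h | h
        · by_contra hc
          rw [← degree_eq_zero, h, degree_eq_zero] at hc
          exact hc hku
        · exact absurd h hu
      have hfr : ∀ v, v = s ∨ v = t → ¬ Touches M v := by
        rintro v hv ⟨e, he, w, rfl⟩
        have := hR v w (Multiset.mem_of_le hMR he)
        tauto
      have := hM.absorb_cycle (u := u) (a := s) (t := t) (p := []) hMu dsu.symm (by simp)
        (by simpa using hfr t (Or.inr rfl)) (by simpa using dst)
      rw [add_comm 1]
      convert this using 2
      simp only [hXdef, List.nil_append, pathEdges_cons_cons, pathEdges_singleton,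
        Multiset.insert_eq_cons, Multiset.cons_zero]

end Step

end PathDecomposition

/-! ### Two low vertices with a common neighbour -/

namespace PathDecomposition

variable {V : Type*} [DecidableEq V] {W : Finset V} {E : Finset (Sym2 V)}

/-- The edges at `s` and `t` are covered by the path s u t, or s u t a when `t` has a second
neighbour. Besides the deleted vertices only `u` and possibly `a` are touched. -/
lemma HoldsBelow.of_pendant_and_low (ih : HoldsBelow V W.card) (hE : IsSparse W E)
    (hT : ∀ a b c, ¬ IsTriangleComponent E a b c) {u s t : V} (hst : s ≠ t)
    (hs : ∀ w, s(s, w) ∈ E ↔ w = u) (htl : IsLow W E t) (htu : s(t, u) ∈ E) :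
    Decomposes E.val (W.card / 2) := by
  have hsu := (hs u).2 rfl
  have dsu := hE.ne hsu
  have dtu := hE.ne htu
  have ms := hE.mem_left hsu
  have mt := hE.mem_left htu
  have hut : s(u, t) ∈ E := by rwa [Sym2.eq_swap]
  rcases htl.neighbors hE htu with ht | ⟨a, hau, ht⟩
  · have hn : [s, u, t].Nodup := by simp; grind
    refine ih.of_delete_decomposes hE hT {s, t} (by intro x; simp; rintro (rfl | rfl) <;> assumption)
      (by simp) (pathEdges [s, u, t]) (nodup_pathEdges hn) (by simp [hsu, hut])
      (forall_edges_of_forall ?_) (card_insert_pair_le ms mt hst) (decomposes_path hn) ?_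
    · intro v hv w hw
      simp only [Finset.mem_insert, Finset.mem_singleton] at hv
      rcases hv with rfl | rfl
      · rw [(hs w).1 hw]; simp
      · rw [(ht w).1 hw, Sym2.eq_swap]; simp
    · simp; grind
  · have hta := (ht a).2 (Or.inr rfl)
    have dta := hE.ne hta
    have das : a ≠ s := by
      rintro rfl; rw [Sym2.eq_swap] at hta; exact dtu ((hs t).1 hta)
    have hn : [s, u, t, a].Nodup := by simp; grind
    refine ih.of_delete_decomposes hE hT {s, t} (by intro x; simp; rintro (rfl | rfl) <;> assumption)
      (by simp) (pathEdges [s, u, t, a]) (nodup_pathEdges hn) (by simp [hsu, hut, hta])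
      (forall_edges_of_forall ?_) (card_insert_pair_le ms mt hst) (decomposes_path hn) ?_
    · intro v hv w hw
      simp only [Finset.mem_insert, Finset.mem_singleton] at hv
      rcases hv with rfl | rfl
      · rw [(hs w).1 hw]; simp
      · rcases (ht w).1 hw with rfl | rfl
        · rw [Sym2.eq_swap]; simp
        · simp
    · simp; grind

/-- Two vertices of degree two with the same two neighbours. -/
lemma HoldsBelow.of_four_cycle (ih : HoldsBelow V W.card) (hE : IsSparse W E)
    (hT : ∀ a b c, ¬ IsTriangleComponent E a b c) {u a s t : V} (dst : s ≠ t) (dua : u ≠ a)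
    (hs : ∀ w, s(s, w) ∈ E ↔ w = u ∨ w = a) (ht : ∀ w, s(t, w) ∈ E ↔ w = u ∨ w = a) :
    Decomposes E.val (W.card / 2) := by
  have hsu := (hs u).2 (Or.inl rfl)
  have htu := (ht u).2 (Or.inl rfl)
  have hsa := (hs a).2 (Or.inr rfl)
  have hta := (ht a).2 (Or.inr rfl)
  have dsu := hE.ne hsu
  have dtu := hE.ne htu
  have dsa := hE.ne hsa
  have dta := hE.ne hta
  have mu := hE.mem_right hsu
  have ma := hE.mem_right hsa
  have ms := hE.mem_left hsu
  have mt := hE.mem_left htu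
  set X : Multiset (Sym2 V) := {s(u, s), s(s, a), s(a, t), s(t, u)} with hXdef
  have hXn : X.Nodup := by simp [hXdef]; grind
  have hXE : ∀ e ∈ X, e ∈ E := by
    simp [hXdef, htu, hsa, Sym2.eq_swap (a := u), Sym2.eq_swap (a := a), hsu, hta]
  have hR : ∀ v w, s(v, w) ∈ E.filter (· ∉ X) → v ≠ s ∧ v ≠ t := by
    intro v w h
    rw [Finset.mem_filter] at h
    refine ⟨?_, ?_⟩ <;> rintro rfl
    · rcases (hs w).1 h.1 with rfl | rfl <;> exact h.2 (by simp [hXdef])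
    · rcases (ht w).1 h.1 with rfl | rfl <;> exact h.2 (by simp [hXdef])
  have hCX : ∀ v ∈ ({s, t} : Finset V), ∀ w, s(v, w) ∈ E → s(v, w) ∈ X := by
    intro v hv w hw
    simp only [Finset.mem_insert, Finset.mem_singleton] at hv
    rcases hv with rfl | rfl
    · rcases (hs w).1 hw with rfl | rfl <;> simp [hXdef]
    · rcases (ht w).1 hw with rfl | rfl <;> simp [hXdef]
  have hR' : ∀ v w, s(v, w) ∈ E → s(v, w) ∈ X ∨ s(v, w) ∈ E.filter (· ∉ X) := by
    intro v w h; rw [Finset.mem_filter]; tauto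
  have hdist : ∀ x y z, IsTriangleComponent (E.filter (· ∉ X)) x y z → x ≠ y ∧ y ≠ z ∧ x ≠ z :=
    fun x y z h => h.distinct (hE.mono (Finset.filter_subset _ _)
      fun e he => hE.support e (Finset.filter_subset _ _ he))
  -- The four-cycle can be absorbed only at a vertex touched by the triangle-free rest. If a
  -- triangle component contains both `u` and `a`, neither is touched, but then the whole component
  -- has five vertices and two explicit paths cover it.
  by_cases hq : ∃ q, IsTriangleComponent (E.filter (· ∉ X)) u a q
  · obtain ⟨q, hq⟩ := hq
    have d := hdist _ _ _ hq
    have hq' := hR q u hq.mem₃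
    have n₁ : [s, u, q, a, t].Nodup := by simp; grind
    have n₂ : [s, a, u, t].Nodup := by simp; grind
    have e₁ := Finset.filter_subset _ _ hq.mem₁
    have e₂ := Finset.filter_subset _ _ hq.mem₂
    have e₃ := Finset.filter_subset _ _ hq.mem₃
    have hsub : ({s, u, q, a, t} : Finset V) ⊆ W := by
      intro x; simp only [Finset.mem_insert, Finset.mem_singleton]
      rintro (rfl | rfl | rfl | rfl | rfl)
      exacts [ms, mu, hE.mem_right e₂, ma, mt]
    have hcard : ({s, u, q, a, t} : Finset V).card = 5 := by
      simpa using List.toFinset_card_of_nodup n₁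
    refine ih.of_delete_decomposes hE hT {s, u, q, a, t} hsub (by simp)
      (pathEdges [s, u, q, a, t] + pathEdges [s, a, u, t]) ?_ ?_ (forall_edges_of_forall ?_)
      (k := 2) ?_ (decomposes_two_paths n₁ n₂) ?_
    · simp; grind
    · rw [Sym2.eq_swap] at e₁ e₂ e₃
      have e₄ : s(q, a) ∈ E := e₂
      simp [hsu, hsa, e₁, e₃, e₄, Sym2.eq_swap (a := u) (b := t), Sym2.eq_swap (a := a) (b := t),
        htu, hta]
    · intro v hv w hw
      have := hR' v w hw
      have := hq.closed s(v, w)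
      have := hs w
      have := ht w
      simp only [hXdef, Multiset.insert_eq_cons, Multiset.mem_cons, Multiset.mem_singleton,
        Finset.mem_insert, Finset.mem_singleton, Sym2.mem_iff, Sym2.eq_iff, pathEdges_cons_cons,
        pathEdges_singleton, Multiset.mem_add, Multiset.notMem_zero] at *
      grind
    · have := Finset.card_le_card hsub
      rw [hcard] at this ⊢
      omega
    · intro a b c ha hb hc hab hbc hac hta
      simp at ha hta
      grind
  -- A triangle component containing just one of `u`, `a` has two vertices with no other edges in
  -- `E`: it is a pendant triangle.
  by_cases hpq : ∃ v p q, (v = u ∨ v = a) ∧ IsTriangleComponent (E.filter (· ∉ X)) v p q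
  · obtain ⟨v, p, q, hv, hpq⟩ := hpq
    have d := hdist _ _ _ hpq
    have hpua : ∀ p q, IsTriangleComponent (E.filter (· ∉ X)) v p q → p ≠ u ∧ p ≠ a := by
      intro p q h
      have d := hdist _ _ _ h
      rcases hv with rfl | rfl
      · exact ⟨d.1.symm, fun h' => hq ⟨q, h' ▸ h⟩⟩
      · exact ⟨fun h' => hq ⟨q, h' ▸ h.swap⟩, d.1.symm⟩
    have key : ∀ p q, IsTriangleComponent (E.filter (· ∉ X)) v p q →
        ∀ w, s(p, w) ∈ E ↔ w = v ∨ w = q := by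
      intro p q h w
      have d := hdist _ _ _ h
      have hp := hpua p q h
      have hp' := hR p q h.mem₂
      constructor
      · intro hw
        have hw' : s(p, w) ∈ E.filter (· ∉ X) := by
          refine (hR' _ _ hw).resolve_left fun hX => ?_
          simp [hXdef] at hX
          grind
        have := h.closed _ hw' (Or.inr (Or.inl (by simp)))
        simp only [Sym2.eq_iff] at this
        grind
      · have e₁ := Finset.filter_subset _ _ h.mem₁
        rintro (rfl | rfl)
        · rwa [Sym2.eq_swap]
        · exact Finset.filter_subset _ _ h.mem₂
    exact ih.of_pendant_triangle hE hT (key p q hpq) (key q p hpq.rotate.swap.rotate.rotate)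
  push Not at hpq
  have hcount := card_insert_pair_le ms mt dst
  have hsub : ({s, t} : Finset V) ⊆ W := by intro x; simp; rintro (rfl | rfl) <;> assumption
  have hcase : ∀ x y, ((x = u ∧ y = a) ∨ (x = a ∧ y = u)) → X = {s(y, t), s(t, x), s(x, s), s(s, y)} →
      Touches (E.filter (· ∉ X)).val x → Decomposes E.val (W.card / 2) := by
    intro x y hxy hXxy hx
    refine ih.of_delete hE hT {s, t} hsub (by simp) X hXn hXE (forall_edges_of_forall hCX)
      hcount ?_ ?_
    · intro a b c _ ha hb hc hab hbc hac hta htb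
      simp [hXdef] at ha hb hc hta htb
      grind
    · intro M j hM hMR hdeg
      have hMx : Touches M x := by
        rcases hdeg x with h | ⟨p, q, h⟩
        · by_contra hc
          rw [← degree_eq_zero, h, degree_eq_zero] at hc
          exact hc hx
        · exact absurd h (hpq _ _ _ (by tauto))
      have hfr : ∀ v, v = s ∨ v = t → ¬ Touches M v := by
        rintro v hv ⟨e, he, w, rfl⟩
        have := hR v w (Multiset.mem_of_le hMR he)
        tauto
      have := hM.absorb_cycle (u := x) (a := y) (t := t) (p := [s]) hMx (by grind)
        (by simpa using dst.symm)
        (by simpa using ⟨hfr t (Or.inr rfl), hfr s (Or.inl rfl)⟩) (by simp; grind)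
      rw [add_comm 1, hXxy]
      convert this using 2
      simp
  by_cases hu : Touches (E.filter (· ∉ X)).val u
  · refine hcase u a (by tauto) ?_ hu
    simp only [hXdef, Multiset.insert_eq_cons, ← Multiset.singleton_add]; abel
  by_cases ha : Touches (E.filter (· ∉ X)).val a
  · refine hcase a u (by tauto) ?_ ha
    rw [hXdef, Sym2.eq_swap (a := u), Sym2.eq_swap (a := s) (b := a),
      Sym2.eq_swap (a := a) (b := t), Sym2.eq_swap (a := t) (b := u)]
    simp only [Multiset.insert_eq_cons, ← Multiset.singleton_add]; abel
  -- Now the four-cycle is a component by itself: four vertices, two paths.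
  have n₁ : [u, s, a, t].Nodup := by simp; grind
  have n₂ : [t, u].Nodup := by simp; grind
  have hsub' : ({u, s, a, t} : Finset V) ⊆ W := by
    intro x; simp only [Finset.mem_insert, Finset.mem_singleton]
    rintro (rfl | rfl | rfl | rfl) <;> assumption
  have hcard : ({u, s, a, t} : Finset V).card = 4 := by
    simpa using List.toFinset_card_of_nodup n₁
  refine ih.of_delete_decomposes hE hT {u, s, a, t} hsub' (by simp) X hXn hXE
    (forall_edges_of_forall ?_) (k := 2) ?_ ?_ ?_
  · intro v hv w hw
    by_contra hX
    have hw' := (hR' _ _ hw).resolve_left hX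
    simp only [Finset.mem_insert, Finset.mem_singleton] at hv
    rcases hv with rfl | rfl | rfl | rfl
    exacts [hu ⟨_, hw', by simp⟩, (hR _ _ hw').1 rfl, ha ⟨_, hw', by simp⟩, (hR _ _ hw').2 rfl]
  · have := Finset.card_le_card hsub'
    rw [hcard] at this ⊢
    omega
  · have := decomposes_two_paths n₁ n₂
    simpa [hXdef, add_comm] using this
  · intro x b c hx hb hc hab hbc hac hta
    simp [hXdef] at hx hta
    grind

/-- A vertex with two neighbours of degree at most two. -/
lemma HoldsBelow.of_two_low_neighbors (ih : HoldsBelow V W.card) (hE : IsSparse W E)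
    (hT : ∀ a b c, ¬ IsTriangleComponent E a b c) {u s t : V} (dst : s ≠ t)
    (hsl : IsLow W E s) (htl : IsLow W E t) (hsu : s(s, u) ∈ E) (htu : s(t, u) ∈ E) :
    Decomposes E.val (W.card / 2) := by
  rcases hsl.neighbors hE hsu with hs | ⟨a, hau, hs⟩
  · exact ih.of_pendant_and_low hE hT dst hs htl htu
  rcases htl.neighbors hE htu with ht | ⟨b, hbu, ht⟩
  · exact ih.of_pendant_and_low hE hT dst.symm ht hsl hsu
  have hsa := (hs a).2 (Or.inr rfl)
  have htb := (ht b).2 (Or.inr rfl)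
  by_cases hat : a = t
  · subst hat
    have : s = b := by
      rw [Sym2.eq_swap] at hsa
      exact ((ht s).1 hsa).resolve_left (hE.ne hsu)
    subst this
    exact ih.of_pendant_triangle hE hT hs ht
  by_cases hab : a = b
  · subst hab
    exact ih.of_four_cycle hE hT dst hau.symm hs ht
  have hbs : b ≠ s := by
    rintro rfl
    rw [Sym2.eq_swap] at htb
    rcases (hs t).1 htb with h | h
    exacts [hE.ne htu h, hat h.symm]
  have dsu := hE.ne hsu
  have dtu := hE.ne htu
  have dsa := hE.ne hsa
  have dtb := hE.ne htb
  have hn : [a, s, u, t, b].Nodup := by simp; grind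
  have ms := hE.mem_left hsu
  have mt := hE.mem_left htu
  have mu := hE.mem_right hsu
  have ma := hE.mem_right hsa
  have mb := hE.mem_right htb
  set X := pathEdges [a, s, u, t, b] with hXdef
  have hXE : ∀ e ∈ X, e ∈ E := by
    simp [hXdef, hsu, htb, Sym2.eq_swap (a := a), Sym2.eq_swap (a := u), hsa, htu]
  have hR : ∀ v w, s(v, w) ∈ E → s(v, w) ∉ X → s(v, w) ∈ E.filter (· ∉ X) := by
    intro v w h h'; rw [Finset.mem_filter]; exact ⟨h, h'⟩
  -- The path a s u t b can touch all of a triangle in the rest only if that triangle is a u b.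
  -- Absorption then fails, but the seven edges on these five vertices split into two paths
  -- directly.
  by_cases hC : IsTriangleComponent (E.filter (· ∉ X)) a u b
  · have n₁ : [s, a, u, t, b].Nodup := by simp; grind
    have n₂ : [s, u, b, a].Nodup := by simp; grind
    have e₁ := Finset.filter_subset _ _ hC.mem₁
    have e₂ := Finset.filter_subset _ _ hC.mem₂
    have e₃ := Finset.filter_subset _ _ hC.mem₃
    have hsub : ({s, a, u, t, b} : Finset V) ⊆ W := by
      intro x; simp only [Finset.mem_insert, Finset.mem_singleton]
      rintro (rfl | rfl | rfl | rfl | rfl) <;> assumption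
    have hcard : ({s, a, u, t, b} : Finset V).card = 5 := by
      simpa using List.toFinset_card_of_nodup n₁
    refine ih.of_delete_decomposes hE hT {s, a, u, t, b} hsub (by simp)
      (pathEdges [s, a, u, t, b] + pathEdges [s, u, b, a]) ?_ ?_ (forall_edges_of_forall ?_)
      (k := 2) ?_ (decomposes_two_paths n₁ n₂) ?_
    · simp; grind
    · simp [hsu, hsa, e₁, e₂, e₃, htb, Sym2.eq_swap (a := u) (b := t), htu]
    · intro v hv w hw
      have := hR v w hw
      have := hC.closed s(v, w)
      have := hs w
      have := ht w
      simp only [hXdef, Multiset.mem_cons,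
        Finset.mem_insert, Finset.mem_singleton, Sym2.mem_iff, Sym2.eq_iff, pathEdges_cons_cons,
        pathEdges_singleton, Multiset.mem_add, Multiset.notMem_zero] at *
      grind
    · have := Finset.card_le_card hsub
      rw [hcard] at this ⊢
      omega
    · intro a b c ha hb hc hab hbc hac hta
      simp at ha hta
      grind
  · refine ih.of_delete hE hT {s, t} (by intro x; simp; rintro (rfl | rfl) <;> assumption)
      (by simp) X (nodup_pathEdges hn) hXE (forall_edges_of_forall ?_)
      (card_insert_pair_le ms mt dst) ?_ fun M j hM _ _ => (decomposes_path hn).add hM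
    · intro v hv w hw
      simp only [Finset.mem_insert, Finset.mem_singleton] at hv
      rcases hv with rfl | rfl
      · rcases (hs w).1 hw with rfl | rfl <;> simp [hXdef]
      · rcases (ht w).1 hw with rfl | rfl <;> simp [hXdef]
    · intro x y z h hx hy hz hxy hyz hxz tx ty tz
      have key : ∀ v, v ∉ ({s, t} : Finset V) → Touches X v → v = a ∨ v = u ∨ v = b := by
        intro v hv tv
        simp [hXdef] at hv tv
        grind
      have h₁ := h.rotate
      have h₂ := h₁.rotate
      have h₃ := h.swap
      have h₄ := h₁.swap
      have h₅ := h₂.swap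
      rcases key x hx tx with rfl | rfl | rfl <;> rcases key y hy ty with rfl | rfl | rfl <;>
        rcases key z hz tz with rfl | rfl | rfl <;> contradiction

end PathDecomposition

/-! ### Shortest paths, tails at vertices of odd degree, and bridges -/

namespace PathDecomposition

variable {V : Type*} [DecidableEq V] {W : Finset V} {E : Finset (Sym2 V)}

omit [DecidableEq V] in
/-- A shortest path from `x` to the set `T`. -/
lemma exists_shortest_path {x : V} {T : Set V}
    (h : ∃ t ∈ T, Relation.ReflTransGen (fun v w => s(v, w) ∈ E) x t) :
    ∃ (l : List V) (b : V), b ∈ T ∧ (l ++ [b]).Nodup ∧ (l ++ [b]).head? = some x ∧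
      (∀ e ∈ pathEdges (l ++ [b]), e ∈ E) ∧ (∀ v ∈ l, v ∉ T) ∧
      ∀ v ∈ l ++ [b], ∀ w ∈ l ++ [b], v ≠ w → s(v, w) ∈ E → s(v, w) ∈ pathEdges (l ++ [b]) := by
  -- Competitors need not be paths. Distinctness of the vertices, chordlessness and avoidance of `T`
  -- before the end all follow from minimal length.
  let Q : Set (List V) := {l | l.head? = some x ∧ (∃ b ∈ T, l.getLast? = some b) ∧
    ∀ e ∈ pathEdges l, e ∈ E}
  have hQ : Q.Nonempty := by
    obtain ⟨t, ht, hr⟩ := h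
    have : ∃ l : List V, l.head? = some x ∧ l.getLast? = some t ∧ ∀ e ∈ pathEdges l, e ∈ E := by
      clear ht
      induction hr with
      | refl => exact ⟨[x], by simp, by simp, by simp⟩
      | @tail b c _ hbc ih =>
        obtain ⟨l, h₁, h₂, h₃⟩ := ih
        obtain ⟨l, rfl⟩ := List.getLast?_eq_some_iff.1 h₂
        refine ⟨l ++ [b, c], by simpa using h₁, by simp, ?_⟩
        rw [pathEdges_concat]
        simpa using ⟨hbc, h₃⟩
    obtain ⟨l, h₁, h₂, h₃⟩ := this
    exact ⟨l, h₁, ⟨t, ht, h₂⟩, h₃⟩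
  obtain ⟨l, ⟨hx, ⟨b, hb, hl⟩, hE⟩, hmin⟩ := (measure (List.length (α := V))).wf.has_min Q hQ
  obtain ⟨l, rfl⟩ := List.getLast?_eq_some_iff.1 hl
  have hmin' : ∀ l' : List V, l'.length < (l ++ [b]).length → l'.head? = some x →
      (∃ b ∈ T, l'.getLast? = some b) → ¬ ∀ e ∈ pathEdges l', e ∈ E := by
    intro l' hl' h₁ h₂ h₃
    exact hmin l' ⟨h₁, h₂, h₃⟩ hl'
  have hlast : ∀ l₁ l₂ : List V, ∀ c, l₁ ++ c :: l₂ = l ++ [b] → ∀ l₃ : List V,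
      (∃ b ∈ T, (l₃ ++ c :: l₂).getLast? = some b) := by
    intro l₁ l₂ c h l₃
    rw [← h] at hl
    refine ⟨b, hb, ?_⟩
    rw [List.getLast?_append_of_ne_nil _ (by simp)] at hl ⊢
    exact hl
  -- Between `c` and `d` the walk can be shortcut when they coincide, or when they are adjacent
  -- without being consecutive.
  have hshort : ∀ l₁ m l₂ : List V, ∀ c d, l₁ ++ c :: (m ++ d :: l₂) = l ++ [b] →
      c ≠ d ∧ (s(c, d) ∈ E → s(c, d) ∈ pathEdges (l ++ [b])) := by
    intro l₁ m l₂ c d h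
    have hE' : ∀ e, e ∈ pathEdges (l₁ ++ [c]) ∨ e ∈ pathEdges (d :: l₂) → e ∈ E := by
      rw [← h, pathEdges_append_cons, ← List.cons_append, pathEdges_append_cons (c :: m)] at hE
      simp only [Multiset.mem_add] at hE
      intro e he; exact hE e (by tauto)
    have hx' : (l₁ ++ [c]).head? = some x := by
      rw [← h] at hx; cases l₁ <;> simpa using hx
    have hl' := hlast (l₁ ++ c :: m) l₂ d (by simpa using h)
    constructor
    · rintro rfl
      refine hmin' (l₁ ++ c :: l₂) (by rw [← h]; simp) (by cases l₁ <;> simpa using hx')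
        (hl' _) ?_
      rw [pathEdges_append_cons]
      simpa [or_imp] using hE'
    · intro hcd
      cases m with
      | nil =>
        rw [← h, pathEdges_append_cons]; simp
      | cons y m =>
        refine absurd ?_ (hmin' (l₁ ++ c :: d :: l₂) (by rw [← h]; simp)
          (by cases l₁ <;> simpa using hx') (by simpa using hl' (l₁ ++ [c])))
        rw [pathEdges_append_cons, pathEdges_cons_cons]
        simp only [Multiset.mem_add, Multiset.mem_cons]
        rintro e (he | rfl | he)
        exacts [hE' e (Or.inl he), hcd, hE' e (Or.inr he)]
  have hnodup : ∀ l' l₀ : List V, l₀ ++ l' = l ++ [b] → l'.Nodup := by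
    intro l'
    induction l' with
    | nil => simp
    | cons c l' ih =>
      intro l₀ h
      refine List.nodup_cons.2 ⟨fun hc => ?_, ih (l₀ ++ [c]) (by simpa using h)⟩
      obtain ⟨m, l₂, rfl⟩ := List.append_of_mem hc
      exact (hshort l₀ m l₂ c c h).1 rfl
  refine ⟨l, b, hb, hnodup _ [] rfl, hx, hE, fun v hv hvT => ?_, fun v hv w hw hvw hE' => ?_⟩
  · obtain ⟨l₁, l₂, rfl⟩ := List.append_of_mem hv
    refine hmin' (l₁ ++ [v]) (by simp) (by cases l₁ <;> simpa using hx) ⟨v, hvT, by simp⟩ ?_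
    intro e he
    refine hE e ?_
    rw [List.append_assoc, List.cons_append, pathEdges_append_cons]
    exact Multiset.mem_add.2 (Or.inl he)
  · obtain ⟨l₁, l₂, h⟩ := List.append_of_mem hv
    rw [h, List.mem_append, List.mem_cons] at hw
    rcases hw with hw | rfl | hw
    · obtain ⟨l₃, l₄, rfl⟩ := List.append_of_mem hw
      rw [Sym2.eq_swap]
      rw [Sym2.eq_swap] at hE'
      exact (hshort l₃ l₄ l₂ w v (by simpa using h.symm)).2 hE'
    · exact absurd rfl hvw
    · obtain ⟨l₃, l₄, rfl⟩ := List.append_of_mem hw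
      exact (hshort l₁ l₃ l₄ v w h.symm).2 hE'

/-- This serves parity: a vertex of odd degree lies in no triangle component, so removing these
components does not change its degree. -/
lemma IsTriangleComponent.degree_eq_two {a b c : V} (h : IsTriangleComponent E a b c)
    (hE : IsSparse W E) : degree E.val a = 2 := by
  have d := h.distinct hE
  have hn : ({s(a, b), s(b, c), s(c, a)} : Multiset (Sym2 V)).Nodup := by simp; grind
  rw [val_eq_add_filter hn (by simp [h.mem₁, h.mem₂, h.mem₃]), degree_add,
    (degree_eq_zero (v := a)).2 (?_ : ¬ Touches (Finset.val _) a)]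
  · simp [d]
  · rintro ⟨e, he, hae⟩
    have := Finset.mem_filter.1 he
    exact this.2 (by simpa using h.closed e this.1 (Or.inl hae))

/-- Two vertices `s`, `u` are deleted; their edges form, together with some others, one path and
a fresh tail at a vertex that has odd degree in the rest. -/
lemma HoldsBelow.of_path_and_tail (ih : HoldsBelow V W.card) (hE : IsSparse W E)
    (hT : ∀ a b c, ¬ IsTriangleComponent E a b c) {s u v : V} (hsu : s(s, u) ∈ E)
    {t l : List V} (ht : (v :: t).Nodup) (hl : l.Nodup) (hts : ∀ w ∈ t, w = s ∨ w = u)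
    (hd : ∀ e ∈ pathEdges (v :: t), e ∉ pathEdges l)
    (htE : ∀ e ∈ pathEdges (v :: t), e ∈ E) (hlE : ∀ e ∈ pathEdges l, e ∈ E)
    (hs : ∀ w, s(s, w) ∈ E → s(s, w) ∈ pathEdges (v :: t) + pathEdges l)
    (hu : ∀ w, s(u, w) ∈ E → s(u, w) ∈ pathEdges (v :: t) + pathEdges l)
    (hodd : Odd (degree E.val v + degree (pathEdges (v :: t) + pathEdges l) v))
    (htouch : ∀ a b c, IsTriangleComponent (E.filter (· ∉ pathEdges (v :: t) + pathEdges l)) a b c →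
      a ≠ b → b ≠ c → a ≠ c → a ≠ v → b ≠ v → c ≠ v → a ≠ s → b ≠ s → c ≠ s →
      a ≠ u → b ≠ u → c ≠ u → Touches (pathEdges l) a → Touches (pathEdges l) b →
      Touches (pathEdges l) c → False) :
    Decomposes E.val (W.card / 2) := by
  have ms := hE.mem_left hsu
  have mu := hE.mem_right hsu
  have hX : (pathEdges (v :: t) + pathEdges l).Nodup :=
    Multiset.nodup_add.2 ⟨nodup_pathEdges ht, nodup_pathEdges hl, Multiset.disjoint_left.2
      fun {e} he he' => hd e he he'⟩
  have hXE : ∀ e ∈ pathEdges (v :: t) + pathEdges l, e ∈ E := fun e he =>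
    (Multiset.mem_add.1 he).elim (htE e) (hlE e)
  have hR : IsSparse W (E.filter (· ∉ pathEdges (v :: t) + pathEdges l)) :=
    hE.mono (Finset.filter_subset _ _) fun e he => hE.support e (Finset.filter_subset _ _ he)
  -- Degrees in the rest are differences, which have the parity of the sums in `hodd`.
  have hoddR : Odd (degree (E.filter (· ∉ pathEdges (v :: t) + pathEdges l)).val v) := by
    have := congrArg (degree · v) (val_eq_add_filter hX hXE)
    simp only [degree_add] at this hodd
    rw [this] at hodd
    rw [Nat.odd_iff] at hodd ⊢
    omega
  have hvT : ∀ b c, ¬ IsTriangleComponent (E.filter (· ∉ pathEdges (v :: t) + pathEdges l)) v b c :=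
    fun b c h => by rw [h.degree_eq_two hR] at hoddR; exact absurd hoddR (by decide)
  refine ih.of_delete hE hT {s, u} (by intro x; simp; rintro (rfl | rfl) <;> assumption)
    (by simp) _ hX hXE (forall_edges_of_forall ?_) (card_insert_pair_le ms mu (hE.ne hsu)) ?_ ?_
  · intro x hx w hw
    simp only [Finset.mem_insert, Finset.mem_singleton] at hx
    rcases hx with rfl | rfl
    exacts [hs w hw, hu w hw]
  · intro a b c h ha hb hc hab hbc hac ta tb tc
    have hav : a ≠ v := by rintro rfl; exact hvT _ _ h
    have hbv : b ≠ v := by rintro rfl; exact hvT _ _ h.rotate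
    have hcv : c ≠ v := by rintro rfl; exact hvT _ _ h.rotate.rotate
    have key : ∀ x, x ≠ v → x ∉ ({s, u} : Finset V) →
        Touches (pathEdges (v :: t) + pathEdges l) x → Touches (pathEdges l) x := by
      intro x hx hx' htx
      rcases (touches_add _ _ _).1 htx with h | h
      · exfalso
        rcases List.mem_cons.1 h.mem with h | h
        · exact hx h
        · exact hx' (by simpa using hts x h)
      · exact h
    have ta' := key a hav ha ta
    have tb' := key b hbv hb tb
    have tc' := key c hcv hc tc
    simp only [Finset.mem_insert, Finset.mem_singleton, not_or] at ha hb hc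
    exact htouch a b c h hab hbc hac hav hbv hcv ha.1 hb.1 hc.1 ha.2 hb.2 hc.2 ta' tb' tc'
  · intro M j hM hMR hdeg
    have hMv : Odd (degree M v) := by
      rcases hdeg v with h | ⟨b, c, h⟩
      · rwa [h]
      · exact absurd h (hvT b c)
    -- Only `l` costs a path; the tail prolongs a path that ends at `v`.
    have := (decomposes_path hl).add (hM.extend hMv ht fun w hw => ?_)
    · convert this using 1
      abel
    · rintro ⟨e, he, x, rfl⟩
      have := Finset.mem_filter.1 (Multiset.mem_of_le hMR he)
      rcases hts w hw with rfl | rfl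
      exacts [this.2 (hs x this.1), this.2 (hu x this.1)]

/-- The edges avoiding two vertices. -/
def avoiding (E : Finset (Sym2 V)) (s u : V) : Finset (Sym2 V) :=
  E.filter fun e => s ∉ e ∧ u ∉ e

lemma mem_avoiding {s u : V} {e : Sym2 V} : e ∈ avoiding E s u ↔ e ∈ E ∧ s ∉ e ∧ u ∉ e := by
  simp [avoiding]

/-- Let `A` be the set reached from `x`. It misses `T`, while all edges at `s` and `u` except `ux`
stay in {s, u} or lead to `T`. Hence `xu` is the only edge leaving `A`, and as the order is odd,
either `A` or its complement is an even side for `HoldsBelow.of_bridge`. -/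
lemma HoldsBelow.of_unreachable (ih : HoldsBelow V W.card) (hE : IsSparse W E)
    (hT : ∀ a b c, ¬ IsTriangleComponent E a b c) (hW : Odd W.card) {s u x y : V} {T : Set V}
    (hsu : s(s, u) ∈ E) (hux : s(u, x) ∈ E)
    (hu : ∀ w, s(u, w) ∈ E → w = s ∨ w = x ∨ w = y) (hs : ∀ w, s(s, w) ∈ E → w = u ∨ w ∈ T)
    (hy : y ∈ T) (hxT : x ∉ T) (hxs : x ≠ s) (hz : ∃ z, z ≠ u ∧ s(x, z) ∈ E)
    (h : ¬ ∃ t ∈ T, Relation.ReflTransGen (fun v w => s(v, w) ∈ avoiding E s u) x t) :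
    Decomposes E.val (W.card / 2) := by
  classical
  push Not at h
  have dux := hE.ne hux
  set A := W.filter (Relation.ReflTransGen (fun v w => s(v, w) ∈ avoiding E s u) x) with hA
  have mx := hE.mem_right hux
  have hxA : x ∈ A := Finset.mem_filter.2 ⟨mx, .refl⟩
  have hav : ∀ v ∈ A, v ≠ s ∧ v ≠ u := by
    intro v hv
    rcases Relation.ReflTransGen.cases_tail (Finset.mem_filter.1 hv).2 with rfl | ⟨w, -, hw⟩
    · exact ⟨hxs, dux.symm⟩
    · have := mem_avoiding.1 hw
      simp only [Sym2.mem_iff] at this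
      grind
  have hstep : ∀ v w, v ∈ A → s(v, w) ∈ E → w ≠ s → w ≠ u → w ∈ A := by
    intro v w hv hvw hws hwu
    have := hav v hv
    refine Finset.mem_filter.2 ⟨hE.mem_right hvw, (Finset.mem_filter.1 hv).2.tail ?_⟩
    rw [mem_avoiding]
    simp only [Sym2.mem_iff]
    grind
  have hAT : ∀ v ∈ A, v ∉ T := fun v hv hvT => h v hvT (Finset.mem_filter.1 hv).2
  have hb : ∀ v w, s(v, w) ∈ E → s(v, w) ≠ s(x, u) → v ∈ A → w ∈ A := by
    intro v w hvw hne hv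
    have hv' := hav v hv
    refine hstep v w hv hvw ?_ ?_
    · rintro rfl
      rw [Sym2.eq_swap] at hvw
      rcases hs v hvw with h | h
      exacts [hv'.2 h, hAT v hv h]
    · rintro rfl
      rw [Sym2.eq_swap] at hvw
      rcases hu v hvw with h | rfl | rfl
      exacts [hv'.1 h, hne rfl, hAT v hv hy]
  have hb' : ∀ e ∈ E, e ≠ s(x, u) → ∀ v ∈ e, ∀ w ∈ e, v ∈ A → w ∈ A := by
    rintro e he hne v ⟨v', rfl⟩ w hw hvA
    rcases Sym2.mem_iff.1 hw with rfl | rfl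
    exacts [hvA, hb _ _ he hne hvA]
  have hAW : A ⊆ W := Finset.filter_subset _ _
  have hcard := Finset.card_sdiff_add_card_eq_card hAW
  have huA : u ∉ A := fun h => (hav u h).2 rfl
  rcases Nat.even_or_odd A.card with hev | hodd
  · refine ih.of_bridge hE hT hAW hev hW ?_ hxA huA (by rwa [Sym2.eq_swap]) hb'
    have : ({s, u} : Finset V) ⊆ W \ A := by
      intro v
      simp only [Finset.mem_insert, Finset.mem_singleton, Finset.mem_sdiff]
      rintro (rfl | rfl)
      exacts [⟨hE.mem_left hsu, fun h => (hav v h).1 rfl⟩, ⟨hE.mem_right hsu, huA⟩]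
    have := Finset.card_le_card this
    rw [Finset.card_pair (hE.ne hsu)] at this
    omega
  · refine ih.of_bridge hE hT (A := W \ A) Finset.sdiff_subset ?_ hW ?_
      (Finset.mem_sdiff.2 ⟨hE.mem_right hsu, huA⟩) (by simp [hxA]) hux ?_
    · rw [Nat.odd_iff] at hodd hW
      rw [Nat.even_iff]
      omega
    -- The induction hypothesis will be applied to the complement of `A` together with `x`, so `A`
    -- needs a second vertex.
    · obtain ⟨z, hzu, hz⟩ := hz
      have hzs : z ≠ s := by
        rintro rfl
        rw [Sym2.eq_swap] at hz
        exact (hs x hz).elim dux.symm hxT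
      have : ({x, z} : Finset V) ⊆ A := by
        intro v
        simp only [Finset.mem_insert, Finset.mem_singleton]
        rintro (rfl | rfl)
        exacts [hxA, hstep _ _ hxA hz hzs hzu]
      have := Finset.card_le_card this
      rw [Finset.card_pair (hE.ne hz)] at this
      omega
    · intro e he hne v hv w hw hvA
      rw [Finset.mem_sdiff] at hvA ⊢
      refine ⟨hE.support e he w hw, fun hwA => hvA.2 ?_⟩
      exact hb' e he (by rwa [Sym2.eq_swap]) w hw v hv hwA

end PathDecomposition

/-! ### The pivot of degree three -/

namespace PathDecomposition

variable {V : Type*} [DecidableEq V] {W : Finset V} {E : Finset (Sym2 V)}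

/-- Here `p` is the chordless path, `N` holds the other edges of the new path `l`, and `z` is the
one vertex that `l` may have outside `p`, `s` and `u`. A triangle in the rest touched at all three
vertices would have two of them on `p`, and the edge between these belongs to `p`, hence is deleted.
The final 1 in `hodd` is the degree of `p` at its end `v`. -/
lemma HoldsBelow.of_induced_path (ih : HoldsBelow V W.card) (hE : IsSparse W E)
    (hT : ∀ a b c, ¬ IsTriangleComponent E a b c) {s u v z : V} (hsu : s(s, u) ∈ E)
    {t l p : List V} {N : Multiset (Sym2 V)} (hp : ∀ e ∈ pathEdges p, e ∈ avoiding E s u)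
    (hind : ∀ a ∈ p, ∀ b ∈ p, a ≠ b → s(a, b) ∈ avoiding E s u → s(a, b) ∈ pathEdges p)
    (hpv : degree (pathEdges p) v = 1) (hlp : pathEdges l = pathEdges p + N)
    (hlz : ∀ w ∈ l, w ∈ p ∨ w = s ∨ w = u ∨ w = z)
    (ht : (v :: t).Nodup) (hl : l.Nodup) (hts : ∀ w ∈ t, w = s ∨ w = u)
    (hd : ∀ e ∈ pathEdges (v :: t), (s ∈ e ∨ u ∈ e) ∧ e ∉ N ∧ e ∈ E)
    (hN : ∀ e ∈ N, e ∈ E)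
    (hs : ∀ w, s(s, w) ∈ E → s(s, w) ∈ pathEdges (v :: t) + N)
    (hu : ∀ w, s(u, w) ∈ E → s(u, w) ∈ pathEdges (v :: t) + N)
    (hodd : Odd (degree E.val v + degree (pathEdges (v :: t) + N) v + 1)) :
    Decomposes E.val (W.card / 2) := by
  refine ih.of_path_and_tail hE hT hsu ht hl hts ?_ (fun e he => (hd e he).2.2) ?_ ?_ ?_ ?_ ?_
  · intro e he hel
    rw [hlp, Multiset.mem_add] at hel
    rcases hel with h | h
    · have := mem_avoiding.1 (hp e h)
      have := hd e he
      tauto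
    · exact (hd e he).2.1 h
  · intro e he
    rw [hlp, Multiset.mem_add] at he
    exact he.elim (fun h => (mem_avoiding.1 (hp e h)).1) (hN e)
  · intro w hw
    have := hs w hw
    simp only [hlp, Multiset.mem_add] at this ⊢
    tauto
  · intro w hw
    have := hu w hw
    simp only [hlp, Multiset.mem_add] at this ⊢
    tauto
  · convert hodd using 1
    simp only [hlp, degree_add, hpv]
    omega
  · intro a b c h hab hbc hac _ _ _ has hbs hcs hau hbu hcu ta tb tc
    have key : ∀ x y, s(x, y) ∈ E.filter (· ∉ pathEdges (v :: t) + pathEdges l) → x ≠ y →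
        x ≠ s → y ≠ s → x ≠ u → y ≠ u → x ∈ p → y ∈ p → False := by
      intro x y hxy hne hxs hys hxu hyu hx hy
      rw [Finset.mem_filter] at hxy
      refine hxy.2 (Multiset.mem_add.2 (Or.inr ?_))
      rw [hlp, Multiset.mem_add]
      left
      refine hind x hx y hy hne (mem_avoiding.2 ⟨hxy.1, ?_⟩)
      simp only [Sym2.mem_iff]
      grind
    have hab' := key a b h.mem₁ hab has hbs hau hbu
    have hbc' := key b c h.mem₂ hbc hbs hcs hbu hcu
    have hca' := key c a h.mem₃ hac.symm hcs has hcu hau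
    have ha := hlz a ta.mem
    have hb := hlz b tb.mem
    have hc := hlz c tc.mem
    grind

omit [DecidableEq V] in
lemma pathEdges_cons_of_head? {p : List V} {x : V} (hx : p.head? = some x) (a : V) :
    pathEdges (a :: p) = s(a, x) ::ₘ pathEdges p := by
  cases p with
  | nil => simp at hx
  | cons b p => obtain rfl : b = x := by simpa using hx
                simp

lemma degree_pathEdges_of_head? {l : List V} {b x : V} (hn : (l ++ [b]).Nodup)
    (hx : (l ++ [b]).head? = some x) (hb : b ≠ x) : degree (pathEdges (l ++ [b])) x = 1 := by
  rcases l with - | ⟨c, l⟩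
  · simp at hx; exact absurd hx hb
  obtain rfl : c = x := by simpa using hx
  rcases l with - | ⟨d, l⟩
  exacts [degree_pathEdges_head hn, degree_pathEdges_head hn]

lemma degree_pathEdges_last {l : List V} {b x : V} (hn : (l ++ [b]).Nodup)
    (hx : (l ++ [b]).head? = some x) (hb : b ≠ x) : degree (pathEdges (l ++ [b])) b = 1 := by
  rcases List.eq_nil_or_concat' l with rfl | ⟨l, c, rfl⟩
  · simp at hx; exact absurd hx hb
  rw [← pathEdges_reverse]
  have := List.nodup_reverse.2 hn
  simp only [List.reverse_append, List.reverse_cons, List.reverse_nil, List.nil_append,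
    List.cons_append] at this ⊢
  exact degree_pathEdges_head this

/-- Distinct ends force an edge, so every vertex of the path lies on an edge avoiding `s` and `u`.
-/
lemma ne_of_mem_of_avoiding {l : List V} {b x s u : V} (hn : (l ++ [b]).Nodup)
    (hx : (l ++ [b]).head? = some x) (hb : b ≠ x)
    (hp : ∀ e ∈ pathEdges (l ++ [b]), e ∈ avoiding E s u) : ∀ w ∈ l ++ [b], w ≠ s ∧ w ≠ u := by
  intro w hw
  have hd := degree_pathEdges_of_head? hn hx hb
  have hne : ∃ e, e ∈ pathEdges (l ++ [b]) := by
    by_contra! hc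
    rw [Multiset.eq_zero_of_forall_notMem hc] at hd
    simp at hd
  obtain ⟨e, he⟩ := hne
  obtain ⟨f, hf, hwf⟩ := touches_pathEdges_of_mem hw he
  have := mem_avoiding.1 (hp f hf)
  refine ⟨?_, ?_⟩ <;> rintro rfl <;> tauto

/-- A vertex `u` of degree three with a neighbour `s` of degree two, not in a common triangle. -/
lemma HoldsBelow.of_pivot_apart (ih : HoldsBelow V W.card) (hE : IsSparse W E)
    (hT : ∀ a b c, ¬ IsTriangleComponent E a b c) (hW : Odd W.card) {s u x y a : V}
    (hs : ∀ w, s(s, w) ∈ E ↔ w = u ∨ w = a) (hu : ∀ w, s(u, w) ∈ E ↔ w = s ∨ w = x ∨ w = y)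
    (hxs : x ≠ s) (hys : y ≠ s) (hxy : x ≠ y) (hau : a ≠ u) (hax : a ≠ x) (hay : a ≠ y)
    (hz : ∃ z, z ≠ u ∧ s(x, z) ∈ E) : Decomposes E.val (W.card / 2) := by
  have hsu := (hs u).2 (Or.inl rfl)
  have hsa := (hs a).2 (Or.inr rfl)
  have hus := (hu s).2 (Or.inl rfl)
  have hux := (hu x).2 (Or.inr (Or.inl rfl))
  have huy := (hu y).2 (Or.inr (Or.inr rfl))
  have has : s(a, s) ∈ E := by rwa [Sym2.eq_swap]
  have hxu : s(x, u) ∈ E := by rwa [Sym2.eq_swap]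
  have hyu : s(y, u) ∈ E := by rwa [Sym2.eq_swap]
  have dsu := hE.ne hsu
  have dux := hE.ne hux
  have duy := hE.ne huy
  have dsa := hE.ne hsa
  by_cases hoa : Even (degree E.val a)
  · refine ih.of_path_and_tail hE hT hsu (v := a) (t := [s, u]) (l := [x, u, y]) (by simp; grind)
      (by simp; grind) (by simp) (by simp; grind) (by simp; grind) (by simp; grind) ?_ ?_ ?_ ?_
    · intro w hw
      rcases (hs w).1 hw with rfl | rfl <;> simp
    · intro w hw
      rcases (hu w).1 hw with rfl | rfl | rfl <;> simp
    · have : degree (pathEdges [a, s, u] + pathEdges [x, u, y]) a = 1 := by simp; grind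
      rw [this]; exact hoa.add_one
    · intro a b c _ hab hbc hac _ _ _ _ _ _ _ _ _ ta tb tc
      simp at ta tb tc
      grind
  by_cases hox : Even (degree E.val x)
  · refine ih.of_path_and_tail hE hT hsu (v := x) (t := [u]) (l := [a, s, u, y]) (by simp; grind)
      (by simp; grind) (by simp) (by simp; grind) (by simp; grind) (by simp; grind) ?_ ?_ ?_ ?_
    · intro w hw
      rcases (hs w).1 hw with rfl | rfl <;> simp
    · intro w hw
      rcases (hu w).1 hw with rfl | rfl | rfl <;> simp
    · have : degree (pathEdges [x, u] + pathEdges [a, s, u, y]) x = 1 := by simp; grind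
      rw [this]; exact hox.add_one
    · intro a b c _ hab hbc hac _ _ _ _ _ _ _ _ _ ta tb tc
      simp at ta tb tc
      grind
  -- Stopping at the first of `a`, `y` leaves the other unvisited, so the path can continue to it
  -- through `s` and `u`.
  by_cases hre : ∃ t ∈ ({a, y} : Set V),
      Relation.ReflTransGen (fun v w => s(v, w) ∈ avoiding E s u) x t
  swap
  · exact ih.of_unreachable hE hT hW hsu hux (fun w hw => (hu w).1 hw)
      (fun w hw => ((hs w).1 hw).imp_right fun h => by simp [h]) (by simp) (by simp; grind) hxs hz
      hre
  obtain ⟨l, b, hb, hn, hhead, hpE, hlT, hind⟩ := exists_shortest_path hre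
  have hbx : b ≠ x := by rintro rfl; simp at hb; grind
  have hav := ne_of_mem_of_avoiding hn hhead hbx hpE
  have hla : a ∉ l := fun h => hlT a h (by simp)
  have hly : y ∉ l := fun h => hlT y h (by simp)
  have hls : s ∉ l := fun h => (hav s (by simp [h])).1 rfl
  have hlu : u ∉ l := fun h => (hav u (by simp [h])).2 rfl
  rw [Nat.not_even_iff_odd] at hox
  rcases hb with rfl | hb
  · refine ih.of_induced_path hE hT hsu (v := x) (z := y) (t := [u]) (l := l ++ b :: [s, u, y])
      (N := pathEdges [b, s, u, y]) hpE hind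
      (degree_pathEdges_of_head? hn hhead hbx) (pathEdges_append_cons _ _ _) (by simp; grind)
      (by simp; grind) ?_ (by simp) (by simp; grind) (by simp; grind) ?_ ?_ ?_
    · simp only [List.nodup_append, List.nodup_cons, List.mem_cons] at hn ⊢
      grind
    · intro w hw
      rcases (hs w).1 hw with rfl | rfl <;> simp
    · intro w hw
      rcases (hu w).1 hw with rfl | rfl | rfl <;> simp
    · have : degree (pathEdges [x, u] + pathEdges [b, s, u, y]) x = 1 := by simp; grind
      rw [this]; exact hox.add_one.add_one
  · obtain rfl : b = y := hb
    refine ih.of_induced_path hE hT hsu (v := x) (z := a) (t := [u]) (l := l ++ b :: [u, s, a])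
      (N := pathEdges [b, u, s, a]) hpE hind
      (degree_pathEdges_of_head? hn hhead hbx) (pathEdges_append_cons _ _ _) (by simp; grind)
      (by simp; grind) ?_ (by simp) (by simp; grind) (by simp; grind) ?_ ?_ ?_
    · simp only [List.nodup_append, List.nodup_cons, List.mem_cons] at hn ⊢
      grind
    · intro w hw
      rcases (hs w).1 hw with rfl | rfl <;> simp
    · intro w hw
      rcases (hu w).1 hw with rfl | rfl | rfl <;> simp
    · have : degree (pathEdges [x, u] + pathEdges [b, u, s, a]) x = 1 := by simp; grind
      rw [this]; exact hox.add_one.add_one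

/-- A vertex `u` of degree three with a neighbour `s` of degree one. -/
lemma HoldsBelow.of_pivot_pendant (ih : HoldsBelow V W.card) (hE : IsSparse W E)
    (hT : ∀ a b c, ¬ IsTriangleComponent E a b c) (hW : Odd W.card) {s u x y : V}
    (hs : ∀ w, s(s, w) ∈ E ↔ w = u) (hu : ∀ w, s(u, w) ∈ E ↔ w = s ∨ w = x ∨ w = y)
    (hxs : x ≠ s) (hys : y ≠ s) (hxy : x ≠ y) (hz : ∃ z, z ≠ u ∧ s(x, z) ∈ E) :
    Decomposes E.val (W.card / 2) := by
  have hsu := (hs u).2 rfl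
  have hus := (hu s).2 (Or.inl rfl)
  have hux := (hu x).2 (Or.inr (Or.inl rfl))
  have huy := (hu y).2 (Or.inr (Or.inr rfl))
  have hxu : s(x, u) ∈ E := by rwa [Sym2.eq_swap]
  have hyu : s(y, u) ∈ E := by rwa [Sym2.eq_swap]
  have dsu := hE.ne hsu
  have dux := hE.ne hux
  have duy := hE.ne huy
  by_cases hox : Even (degree E.val x)
  · refine ih.of_path_and_tail hE hT hsu (v := x) (t := [u]) (l := [s, u, y]) (by simp; grind)
      (by simp; grind) (by simp) (by simp; grind) (by simp; grind) (by simp; grind) ?_ ?_ ?_ ?_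
    · intro w hw
      rw [(hs w).1 hw]; simp
    · intro w hw
      rcases (hu w).1 hw with rfl | rfl | rfl <;> simp
    · have : degree (pathEdges [x, u] + pathEdges [s, u, y]) x = 1 := by simp; grind
      rw [this]; exact hox.add_one
    · intro a b c _ hab hbc hac _ _ _ _ _ _ _ _ _ ta tb tc
      simp at ta tb tc
      grind
  by_cases hre : ∃ t ∈ ({y} : Set V),
      Relation.ReflTransGen (fun v w => s(v, w) ∈ avoiding E s u) x t
  swap
  · exact ih.of_unreachable (T := {y}) hE hT hW hsu hux (fun w hw => (hu w).1 hw)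
      (fun w hw => Or.inl ((hs w).1 hw)) (by simp) (by simpa) hxs hz hre
  obtain ⟨l, b, rfl, hn, hhead, hpE, hlT, hind⟩ := exists_shortest_path hre
  have hav := ne_of_mem_of_avoiding hn hhead hxy.symm hpE
  have hls : s ∉ l := fun h => (hav s (by simp [h])).1 rfl
  have hlu : u ∉ l := fun h => (hav u (by simp [h])).2 rfl
  rw [Nat.not_even_iff_odd] at hox
  -- The new path has no vertex outside the shortest path, `s` and `u`; `z := s` is a dummy.
  refine ih.of_induced_path hE hT hsu (v := x) (z := s) (t := [u]) (l := l ++ b :: [u, s])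
    (N := pathEdges [b, u, s]) hpE hind
    (degree_pathEdges_of_head? hn hhead hxy.symm) (pathEdges_append_cons _ _ _) (by simp; grind)
    (by simp; grind) ?_ (by simp) (by simp; grind) (by simp; grind) ?_ ?_ ?_
  · simp only [List.nodup_append, List.nodup_cons, List.mem_cons] at hn ⊢
    grind
  · intro w hw
    rw [(hs w).1 hw]; simp
  · intro w hw
    rcases (hu w).1 hw with rfl | rfl | rfl <;> simp
  · have : degree (pathEdges [x, u] + pathEdges [b, u, s]) x = 1 := by simp; grind
    rw [this]; exact hox.add_one.add_one

/-- A vertex `u` of degree three and a vertex `s` of degree two in a common triangle. -/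
lemma HoldsBelow.of_pivot_triangle (ih : HoldsBelow V W.card) (hE : IsSparse W E)
    (hT : ∀ a b c, ¬ IsTriangleComponent E a b c) (hW : Odd W.card) {s u x y : V}
    (hs : ∀ w, s(s, w) ∈ E ↔ w = u ∨ w = x) (hu : ∀ w, s(u, w) ∈ E ↔ w = s ∨ w = x ∨ w = y)
    (hys : y ≠ s) (hxy : x ≠ y) (hz : ∃ z, z ≠ u ∧ s(y, z) ∈ E) :
    Decomposes E.val (W.card / 2) := by
  have hsu := (hs u).2 (Or.inl rfl)
  have hsx := (hs x).2 (Or.inr rfl)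
  have hus := (hu s).2 (Or.inl rfl)
  have hux := (hu x).2 (Or.inr (Or.inl rfl))
  have huy := (hu y).2 (Or.inr (Or.inr rfl))
  have hxs : s(x, s) ∈ E := by rwa [Sym2.eq_swap]
  have hxu : s(x, u) ∈ E := by rwa [Sym2.eq_swap]
  have hyu : s(y, u) ∈ E := by rwa [Sym2.eq_swap]
  have dsu := hE.ne hsu
  have dux := hE.ne hux
  have duy := hE.ne huy
  have dsx := hE.ne hsx
  -- For odd degree at `x`, the tail x s u and the path x u y use two edges at `x` and preserve
  -- parity.
  by_cases hox : Even (degree E.val x)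
  swap
  · rw [Nat.not_even_iff_odd] at hox
    refine ih.of_path_and_tail hE hT hsu (v := x) (t := [s, u]) (l := [x, u, y]) (by simp; grind)
      (by simp; grind) (by simp) (by simp; grind) (by simp; grind) (by simp; grind) ?_ ?_ ?_ ?_
    · intro w hw
      rcases (hs w).1 hw with rfl | rfl <;> simp
    · intro w hw
      rcases (hu w).1 hw with rfl | rfl | rfl <;> simp
    · have : degree (pathEdges [x, s, u] + pathEdges [x, u, y]) x = 2 := by simp; grind
      rw [this]; exact hox.add_one.add_one
    · intro a b c _ hab hbc hac _ _ _ _ _ _ _ _ _ ta tb tc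
      simp at ta tb tc
      grind
  -- For even degree, the path u y … x s and the tail x u s use three edges at `x`.
  by_cases hre : ∃ t ∈ ({x} : Set V),
      Relation.ReflTransGen (fun v w => s(v, w) ∈ avoiding E s u) y t
  swap
  · exact ih.of_unreachable (T := {x}) hE hT hW hsu huy (fun w hw => by have := (hu w).1 hw; tauto)
      (fun w hw => (hs w).1 hw) (by simp) (by simpa using hxy.symm) hys hz hre
  obtain ⟨l, b, rfl, hn, hhead, hpE, hlT, hind⟩ := exists_shortest_path hre
  have hav := ne_of_mem_of_avoiding hn hhead hxy hpE
  have hls : s ∉ l := fun h => (hav s (by simp [h])).1 rfl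
  have hlu : u ∉ l := fun h => (hav u (by simp [h])).2 rfl
  have hedges : pathEdges (u :: (l ++ [b, s])) = pathEdges (l ++ [b]) + {s(u, y), s(b, s)} := by
    rw [pathEdges_cons_of_head? (x := y), pathEdges_concat]
    · simp only [Multiset.insert_eq_cons, ← Multiset.singleton_add]; abel
    · cases l <;> simpa using hhead
  refine ih.of_induced_path hE hT hsu (v := b) (z := s) (t := [u, s]) (l := u :: (l ++ [b, s]))
    (N := {s(u, y), s(b, s)}) hpE hind (degree_pathEdges_last hn hhead hxy) hedges
    (by simp; grind) (by simp; grind) ?_ (by simp) (by simp; grind) (by simp; grind) ?_ ?_ ?_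
  · simp only [List.nodup_append, List.nodup_cons, List.mem_cons, List.mem_append] at hn ⊢
    grind
  · intro w hw
    rcases (hs w).1 hw with rfl | rfl <;> simp
  · intro w hw
    rcases (hu w).1 hw with rfl | rfl | rfl <;> simp
  · have : degree (pathEdges [b, u, s] + {s(u, y), s(b, s)}) b = 2 := by simp; grind
    rw [this]; exact hox.add_one.add_one.add_one

end PathDecomposition

/-! ### Finding the pivot and completing the induction -/

namespace PathDecomposition

variable {V : Type*} [DecidableEq V] {W : Finset V} {E : Finset (Sym2 V)}

/-- Sparsity of the set of vertices that are not low gives `u` with at most two neighbours in it. At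
most one neighbour of `u` is low, yet `u` has at least three neighbours, so both bounds are
attained. -/
lemma exists_pivot (hE : IsSparse W E)
    (hlow : ∀ u s t, s ≠ t → IsLow W E s → IsLow W E t → s(s, u) ∈ E → s(t, u) ∈ E → False)
    (hex : ∃ v ∈ W, ¬ IsLow W E v) :
    ∃ u s x y, IsLow W E s ∧ ¬ IsLow W E x ∧ ¬ IsLow W E y ∧ x ≠ y ∧
      ∀ w, s(u, w) ∈ E ↔ w = s ∨ w = x ∨ w = y := by
  classical
  obtain ⟨u, hu, hc⟩ := hE.sparse (W.filter (¬ IsLow W E ·)) (by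
    obtain ⟨v, hv, h⟩ := hex; exact ⟨v, Finset.mem_filter.2 ⟨hv, h⟩⟩)
  rw [Finset.filter_filter] at hc
  have hu' := (Finset.mem_filter.1 hu).2
  have hsplit := Finset.card_filter_add_card_filter_not (s := W.filter fun w => s(u, w) ∈ E)
    (fun w => IsLow W E w)
  rw [Finset.filter_filter, Finset.filter_filter] at hsplit
  have e : (W.filter fun w => s(u, w) ∈ E ∧ ¬ IsLow W E w) =
    W.filter fun w => ¬ IsLow W E w ∧ s(u, w) ∈ E := by
      apply Finset.filter_congr; intros; tauto
  rw [e] at hsplit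
  have h₁ : (W.filter fun w => s(u, w) ∈ E ∧ IsLow W E w).card ≤ 1 := by
    rw [Finset.card_le_one]
    intro s hs t ht
    simp only [Finset.mem_filter] at hs ht
    by_contra hst
    refine hlow u s t hst hs.2.2 ht.2.2 ?_ ?_ <;> rw [Sym2.eq_swap]
    exacts [hs.2.1, ht.2.1]
  have h₃ : 3 ≤ (W.filter fun w => s(u, w) ∈ E).card := by
    unfold IsLow at hu'; omega
  obtain ⟨s, hs⟩ := Finset.card_eq_one.1 (by omega :
    (W.filter fun w => s(u, w) ∈ E ∧ IsLow W E w).card = 1)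
  obtain ⟨x, y, hxy, hxy'⟩ := Finset.card_eq_two.1 (by omega :
    (W.filter fun w => ¬ IsLow W E w ∧ s(u, w) ∈ E).card = 2)
  have ms : ∀ w, (w ∈ W ∧ s(u, w) ∈ E ∧ IsLow W E w) ↔ w = s := fun w => by
    simpa using Finset.ext_iff.1 hs w
  have mxy : ∀ w, (w ∈ W ∧ ¬ IsLow W E w ∧ s(u, w) ∈ E) ↔ w = x ∨ w = y := fun w => by
    simpa using Finset.ext_iff.1 hxy' w
  refine ⟨u, s, x, y, ((ms s).2 rfl).2.2, ((mxy x).2 (Or.inl rfl)).2.1,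
    ((mxy y).2 (Or.inr rfl)).2.1, hxy, fun w => ?_⟩
  rw [← ms, ← mxy]
  have : s(u, w) ∈ E → w ∈ W := hE.mem_right
  tauto

lemma exists_neighbor_of_not_isLow {v u : V} (h : ¬ IsLow W E v) : ∃ z, z ≠ u ∧ s(v, z) ∈ E := by
  by_contra! hc
  refine h ((Finset.card_le_card (t := {u}) fun w hw => ?_).trans (by simp))
  rw [Finset.mem_filter] at hw
  by_contra hne
  exact hc w (by simpa using hne) hw.2

lemma HoldsBelow.step (ih : HoldsBelow V W.card) (hE : IsSparse W E)
    (hT : ∀ a b c, ¬ IsTriangleComponent E a b c) : Decomposes E.val (W.card / 2) := by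
  rcases W.eq_empty_or_nonempty with rfl | hne
  · have : E = ∅ := by
      refine Finset.eq_empty_of_forall_notMem fun e he => ?_
      induction e with
      | _ v w => simpa using hE.mem_left he
    subst this
    exact ⟨[], by simp, by simp, by simp⟩
  rcases Nat.even_or_odd W.card with hW | hW
  · obtain ⟨v, hv, hc⟩ := hE.sparse W hne
    exact ih.of_even hE hT hW hv hc
  by_cases hlow : ∃ u s t, s ≠ t ∧ IsLow W E s ∧ IsLow W E t ∧ s(s, u) ∈ E ∧ s(t, u) ∈ E
  · obtain ⟨u, s, t, hst, hs, ht, hsu, htu⟩ := hlow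
    exact ih.of_two_low_neighbors hE hT hst hs ht hsu htu
  push Not at hlow
  by_cases hex : ∃ v ∈ W, ¬ IsLow W E v
  · obtain ⟨u, s, x, y, hs, hx, hy, hxy, hu⟩ := exists_pivot hE hlow hex
    have hsu : s(s, u) ∈ E := by rw [Sym2.eq_swap]; exact (hu s).2 (Or.inl rfl)
    have hxs : x ≠ s := by rintro rfl; exact hx hs
    have hys : y ≠ s := by rintro rfl; exact hy hs
    have hzx := exists_neighbor_of_not_isLow (u := u) hx
    have hzy := exists_neighbor_of_not_isLow (u := u) hy
    rcases hs.neighbors hE hsu with h | ⟨a, hau, h⟩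
    · exact ih.of_pivot_pendant hE hT hW h hu hxs hys hxy hzx
    · by_cases hax : a = x
      · subst hax
        exact ih.of_pivot_triangle hE hT hW h hu hys hxy hzy
      · by_cases hay : a = y
        · subst hay
          exact ih.of_pivot_triangle hE hT hW h (fun w => by rw [hu]; tauto) hxs hxy.symm hzx
        · exact ih.of_pivot_apart hE hT hW h hu hxs hys hxy hau hax hay hzx
  -- All vertices are low and none has two low neighbours, so `E` is a matching, and an isolated
  -- vertex or a single edge is removed.
  · push Not at hex
    obtain ⟨v, hv⟩ := hne
    by_cases hiso : ∀ w, s(v, w) ∉ E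
    · exact ih.of_isolated hE hT hv hiso
    push Not at hiso
    obtain ⟨u, hvu⟩ := hiso
    have huv : s(u, v) ∈ E := by rwa [Sym2.eq_swap]
    have one : ∀ v u, s(v, u) ∈ E → ∀ w, s(v, w) ∈ E → w = u := by
      intro v u hvu w hw
      by_contra hne
      refine hlow v w u hne (hex w (hE.mem_right hw)) (hex u (hE.mem_right hvu)) ?_ ?_ <;>
        rwa [Sym2.eq_swap]
    have dvu := hE.ne hvu
    have mu := hE.mem_right hvu
    refine ih.of_delete_decomposes hE hT {v, u}
      (by intro x; simp; rintro (rfl | rfl) <;> assumption) (by simp) (pathEdges [v, u])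
      (by simp) (by simpa) (forall_edges_of_forall ?_) (card_insert_pair_le hv mu dvu)
      (decomposes_path (by simpa)) ?_
    · intro x hx w hw
      simp only [Finset.mem_insert, Finset.mem_singleton] at hx
      rcases hx with rfl | rfl
      · rw [one _ _ hvu w hw]; simp
      · rw [one _ _ huv w hw, Sym2.eq_swap]; simp
    · simp; grind

/-- A sparse edge set without triangle components decomposes into at most half as many paths as
it has vertices. -/
theorem IsSparse.decomposes (hE : IsSparse W E) (hT : ∀ a b c, ¬ IsTriangleComponent E a b c) :
    Decomposes E.val (W.card / 2) := by
  have : ∀ n, HoldsBelow V n := by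
    intro n
    induction n with
    | zero => intro W E h; omega
    | succ n ih =>
      intro W E hW hE hT
      rcases Nat.lt_succ_iff_lt_or_eq.1 hW with h | h
      · exact ih W E h hE hT
      · subst h; exact HoldsBelow.step ih hE hT
  exact (this _).step hE hT

/-! ### Translation to graphs and partitions of the edge set -/

open SimpleGraph

omit [DecidableEq V] in
lemma exists_walk_of_pathEdges {G : SimpleGraph V} {l : List V} (hn : l.Nodup) (hl : l ≠ [])
    (hG : ∀ e ∈ pathEdges l, e ∈ G.edgeSet) :
    ∃ (u v : V) (p : G.Walk u v), p.support = l ∧ (p.edges : Multiset (Sym2 V)) = pathEdges l := by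
  induction l with
  | nil => exact absurd rfl hl
  | cons a l ih =>
    cases l with
    | nil => exact ⟨a, a, .nil, by simp, by simp⟩
    | cons b l =>
      simp only [pathEdges_cons_cons, Multiset.mem_cons, forall_eq_or_imp, mem_edgeSet] at hG
      obtain ⟨u, v, p, hp, he⟩ := ih hn.of_cons (by simp) hG.2
      obtain rfl : u = b := by
        have := p.head_support
        simp only [hp, List.head_cons] at this
        exact this.symm
      exact ⟨a, v, .cons hG.1 p, by simp [hp], by simp [← he]⟩

/-- The sum is a multiset without repetition, so different lists contribute disjoint edge sets.
Lists without edges are dropped, since parts must be nonempty; hence only an inequality. -/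
lemma exists_finpartition {G : SimpleGraph V} (L : List (List V)) (hL : ∀ l ∈ L, l.Nodup)
    {F : Finset (Sym2 V)} (hF : (L.map pathEdges).sum = F.val) (hG : ∀ e ∈ F, e ∈ G.edgeSet) :
    ∃ P : Finpartition F, (∀ t ∈ P.parts, ∃ (u v : V) (p : G.Walk u v), p.IsPath ∧
      p.edges.toFinset = t) ∧ P.parts.card ≤ L.length := by
  induction L generalizing F with
  | nil =>
    have : F = ∅ := by rw [← Finset.val_eq_zero, ← hF]; rfl
    subst this
    exact ⟨Finpartition.empty _, by simp, by simp⟩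
  | cons l L ih =>
    rw [List.map_cons, List.sum_cons] at hF
    have hnd := F.nodup
    rw [← hF, Multiset.nodup_add] at hnd
    obtain ⟨hn₁, hn₂, hdisj⟩ := hnd
    have hF' : F = (⟨pathEdges l, hn₁⟩ : Finset (Sym2 V)) ⊔ ⟨(L.map pathEdges).sum, hn₂⟩ := by
      ext e
      rw [← Finset.mem_val, ← hF]
      simp
    obtain ⟨P, hP, hc⟩ := ih (fun l' hl' => hL l' (by simp [hl']))
      (F := ⟨(L.map pathEdges).sum, hn₂⟩) rfl
      (fun e he => hG e (by rw [hF']; exact Finset.mem_union_right _ he))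
    by_cases hl : pathEdges l = 0
    · have : F = ⟨(L.map pathEdges).sum, hn₂⟩ := by
        apply Finset.val_injective; rw [← hF, hl, zero_add]
      rw [this]
      exact ⟨P, hP, hc.trans (by simp)⟩
    · refine ⟨P.extend (b := ⟨pathEdges l, hn₁⟩) (c := F) ?_ ?_ ?_, ?_, ?_⟩
      · intro h; exact hl (congrArg Finset.val h)
      · rw [Finset.disjoint_left]
        intro e he he'
        exact Multiset.disjoint_left.1 hdisj he' he
      · rw [hF', sup_comm]
      · intro t ht
        rw [Finpartition.extend_parts, Finset.mem_insert] at ht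
        rcases ht with rfl | ht
        · obtain ⟨u, v, p, hp, he⟩ := exists_walk_of_pathEdges (G := G) (hL l (by simp))
            (by rintro rfl; exact hl rfl)
            (fun e he => hG e (by rw [hF']; exact Finset.mem_union_left _ he))
          refine ⟨u, v, p, .mk' (hp ▸ hL l (by simp)), ?_⟩
          ext e
          rw [List.mem_toFinset, ← Multiset.mem_coe, he]
          rfl
        · exact hP t ht
      · rw [Finpartition.extend_parts]
        exact (Finset.card_insert_le _ _).trans (by simpa using hc)

end PathDecomposition

open PathDecomposition in
theorem corollary1 {V : Type*} [Fintype V] [DecidableEq V] (G : SimpleGraph V)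
    [DecidableRel G.Adj] (hdeg : G.IsDegenerate 2)
    (htri : ∀ c : G.ConnectedComponent, IsEmpty (c.toSimpleGraph ≃g SimpleGraph.completeGraph (Fin 3))) :
    ∃ P : Finpartition G.edgeFinset,
      G.IsPathDecomposition P ∧ P.parts.card ≤ Fintype.card V / 2 := by
  have hE : IsSparse Finset.univ G.edgeFinset := by
    refine ⟨by simp, by simp, fun S hS => ?_⟩
    obtain ⟨v, hv, hc⟩ := hdeg ((⊤ : G.Subgraph).induce S) (by simpa using hS)
    refine ⟨v, by simpa using hv, ?_⟩
    have : (((⊤ : G.Subgraph).induce S).neighborSet v) =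
        ((S.filter fun w => s(v, w) ∈ G.edgeFinset : Finset V) : Set V) := by
      ext w
      simp at hv
      simp [hv]
    rw [this, Set.encard_coe_eq_coe_finsetCard] at hc
    exact_mod_cast hc
  have hT : ∀ a b c, ¬ IsTriangleComponent G.edgeFinset a b c := by
    intro a b c h
    have d := h.distinct hE
    have hab : G.Adj a b := by simpa using h.mem₁
    have hbc : G.Adj b c := by simpa using h.mem₂
    have hca : G.Adj c a := by simpa using h.mem₃
    have hstep : ∀ v w, G.Adj v w → v = a ∨ v = b ∨ v = c → w = a ∨ w = b ∨ w = c := by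
      intro v w hvw hv
      have := h.closed s(v, w) (by simpa using hvw) (by simp; tauto)
      simp only [Sym2.eq_iff] at this
      grind
    -- No edge leaves {a, b, c}, so by induction along walks these are the only vertices reachable
    -- from `a`.
    have hsupp : ∀ v, v ∈ (G.connectedComponentMk a).supp ↔ v = a ∨ v = b ∨ v = c := by
      intro v
      rw [SimpleGraph.ConnectedComponent.mem_supp_iff, SimpleGraph.ConnectedComponent.eq]
      constructor
      · rintro h
        obtain ⟨p⟩ := h.symm
        have : ∀ x y (p : G.Walk x y), (x = a ∨ x = b ∨ x = c) → (y = a ∨ y = b ∨ y = c) := by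
          intro x y p
          induction p with
          | nil => exact id
          | cons hadj p ih => exact fun hx => ih (hstep _ _ hadj hx)
        exact this a v p (Or.inl rfl)
      · rintro (rfl | rfl | rfl)
        exacts [.refl _, hab.symm.reachable, hca.reachable]
    have htop : (G.connectedComponentMk a).toSimpleGraph = ⊤ := by
      ext ⟨v, hv⟩ ⟨w, hw⟩
      have h₁ := (hsupp v).1 hv
      have h₂ := (hsupp w).1 hw
      have := hab.symm
      have := hbc.symm
      have := hca.symm
      have hadj : (G.connectedComponentMk a).toSimpleGraph.Adj ⟨v, hv⟩ ⟨w, hw⟩ ↔ G.Adj v w := Iff.rfl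
      rw [hadj, SimpleGraph.top_adj, ne_eq, Subtype.mk.injEq]
      constructor
      · exact fun h => h.ne
      · rcases h₁ with rfl | rfl | rfl <;> rcases h₂ with rfl | rfl | rfl <;> simp [*]
    have hcard : Nat.card (G.connectedComponentMk a).supp = 3 := by
      have : (G.connectedComponentMk a).supp = (({a, b, c} : Finset V) : Set V) := by
        ext v; rw [hsupp]; simp
      rw [this, Nat.card_coe_set_eq, Set.ncard_coe_finset]
      exact Finset.card_eq_three.2 ⟨a, b, c, d.1, d.2.2, d.2.1, rfl⟩
    have e : (G.connectedComponentMk a).supp ≃ Fin 3 := Finite.equivFinOfCardEq hcard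
    refine (htri (G.connectedComponentMk a)).elim ?_
    rw [htop]
    exact SimpleGraph.Iso.completeGraph e
  obtain ⟨L, h₁, h₂, h₃⟩ := hE.decomposes hT
  obtain ⟨P, hP, hc⟩ := exists_finpartition (G := G) L h₁ h₂ (by simp)
  exact ⟨P, hP, hc.trans h₃⟩
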